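/- **Setting.** Let $n,q\ge 1$. A quantum query algorithm acts on $\mathcal A=\mathcal I\otimes\mathcal C\otimes\mathcal W$, where $\mathcal I$ has basis $|i\rangle$, $i\in[n]$, $\mathcal C$ has basis $|c\rangle$, $c\in\mathbb Z_q$, and $\mathcal W$ is an arbitrary complex inner product space; it is given by a unit initial vector $|0\rangle\in\mathcal A$ and arbitrary input-independent unitaries $U_0,U_1,\dots$ on $\mathcal A$. Let $\mathcal X=(\mathbb C^q)^{\otimes n}$, with basis $|x\rangle$, $x\in\mathbb Z_q^n$, and let $O$ be the input oracle $|x\rangle|i\rangle|c\rangle\mapsto\omega_q^{c x_i}|x\rangle|i\rangle|c\rangle$, $\omega_q=e^{2\pi \mathrm i/q}$. The uniform states of the algorithm in $\mathcal X\otimes\mathcal A$ are $$\psi_0=q^{-n/2}\sum_{x\in\mathbb Z_q^n}|x\rangle|0\rangle,\qquad \psi'_t=U_t\psi_t,\qquad \psi_{t+1}=O\psi'_t .$$ For $\sigma\in\mathbb Z_q^n$ let $|\chi_\sigma\rangle=q^{-n/2}\sum_x\omega_q^{\sum_i\sigma(i)x_i}|x\rangle$ be the Fourier basis of $\mathcal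 X$, and $\operatorname{supp}(\sigma)=\{i:\sigma(i)\ne0\}$. For a partition $\mu$ of $[n]$ into non-empty blocks, let $Y_\mu\subseteq\mathbb Z_q^n$ be the set of strings that are constant on every block of $\mu$, and let $\mathcal Y_\mu$ be the space with orthonormal basis $|\mu,y\rangle$, $y\in Y_\mu$. The transfer operator $\Upsilon_\mu\colon\mathcal X\to\mathcal Y_\mu$ is the linear map with $q^{-n/2}|x\rangle\mapsto|Y_\mu|^{-1/2}|\mu,x\rangle$ if $x\in Y_\mu$ and $|x\rangle\mapsto 0$ otherwise. Let $L^+_\mu$ consist of all $S\subseteq[n]$ that have at least $k$ elements in common with some block of $\mu$ (if $\mu$ has a unique $k$-block and no larger blocks, these are the supersets of the $k$-block). Let $\Upsilon^+_\mu\colon\mathcal X\to\mathcal Y_\mu$ be the linear map with $|\chi_\sigma\rangle\mapsto\Upsilon_\mu|\chi_\sigma\rangle$ if $\operatorname{supp}(\sigma)\in L^+_\mu$ and $|\chi_\sigma\rangle\mapsto0$ otherwise. For a finite collection $M_k$ of partitions put $$\Upsilon^+_k\phi=\frac1{\sqrt{|M_k|}}\bigoplus_{\mu\in M_k}\Upsilon^+_\mu\phi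 ,$$ and let $\Upsilon_k^+$ act on $\mathcal X\otimes\mathcal A$ as $\Upsilon_k^+\otimes I_{\mathcal A}$. **Theorem.** For every integer $k\ge2$ and every real $c>0$ there is a constant $C>0$, depending only on $k$ and $c$, such that the following holds for all $n,q\ge1$. Let $\mu_k$ be a partition of $[n]$ that has exactly one block of size $k$, all of whose other blocks have size less than $k$, and that has at least $cn$ blocks of size $\ell$ for every $\ell\in\{1,\dots,k-1\}$. Let $M_k$ be the orbit of $\mu_k$ under the action of the symmetric group on $[n]$. Then for every quantum query algorithm as above and every $t\ge0$, $$\|\Upsilon_k^+\psi'_t\|=\|\Upsilon_k^+\psi_t\|\le C\left(\frac{t^{2^k-1}}{n^{3\cdot2^{k-2}-1}}\right)^{1/2^{k-1}} .$$ -/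

import Mathlib

namespace KDist

open Finset

/-! ## Registers

A register with a finite computational basis `S` is `EuclideanSpace ℂ S`.  If `H` is any complex
inner product space, the tensor product of this register with `H` is the Hilbert sum of copies of
`H` indexed by `S`: the vector `∑ s, |s⟩ ⊗ ψ s` is represented by the function `ψ`. -/

/-- The joint space `ℂ^S ⊗ H`. -/
abbrev Joint (S : Type*) (H : Type*) := PiLp 2 (fun _ : S => H)

/-- The operator `T ⊗ I_H` on joint spaces. -/
noncomputable def tensorId {S S' : Type*} [Fintype S] [DecidableEq S] [Fintype S']
    (H : Type*) [NormedAddCommGroup H] [InnerProductSpace ℂ H]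
    (T : EuclideanSpace ℂ S →ₗ[ℂ] EuclideanSpace ℂ S') (ψ : Joint S H) : Joint S' H :=
  WithLp.toLp 2 fun s' => ∑ s, (T (EuclideanSpace.single s 1)) s' • ψ s

/-- Input strings `x ∈ ℤ_q^n`. -/
abbrev Inp (n q : ℕ) := Fin n → ZMod q

/-- The register `𝒳 = (ℂ^q)^{⊗ n}` storing the input string. -/
abbrev RegX (n q : ℕ) := EuclideanSpace ℂ (Inp n q)

/-- The space `𝒜 = ℐ ⊗ 𝒞 ⊗ 𝒲` of the algorithm: query index `i`, phase `c`, work space `W`. -/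
abbrev RegA (n q : ℕ) (W : Type*) := Joint (Fin n × ZMod q) W

/-! ## Query algorithms and their uniform states -/

/-- A quantum query algorithm: a unit initial vector `|0⟩` and input-independent unitaries
`U_0, U_1, …` on `𝒜`.  (An algorithm making `T` queries only uses `U_0, …, U_T`.) -/
structure QueryAlgorithm (n q : ℕ) (W : Type*) [NeZero q] [NormedAddCommGroup W]
    [InnerProductSpace ℂ W] where
  init : RegA n q W
  norm_init : ‖init‖ = 1
  U : ℕ → (RegA n q W ≃ₗᵢ[ℂ] RegA n q W)

section States

variable {n q : ℕ} [NeZero q] {W : Type*} [NormedAddCommGroup W] [InnerProductSpace ℂ W]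

/-- The input oracle `O : |x⟩|i⟩|c⟩ ↦ ω_q^{c x_i} |x⟩|i⟩|c⟩`, where `ω_q = exp(2πi/q)`. -/
noncomputable def oracle (ψ : Joint (Inp n q) (RegA n q W)) : Joint (Inp n q) (RegA n q W) :=
  WithLp.toLp 2 fun x => WithLp.toLp 2 fun ic =>
    (ZMod.stdAddChar (ic.2 * x ic.1) : ℂ) • ψ x ic

/-- The operator `I_𝒳 ⊗ U`. -/
noncomputable def applyA (U : RegA n q W ≃ₗᵢ[ℂ] RegA n q W)
    (ψ : Joint (Inp n q) (RegA n q W)) : Joint (Inp n q) (RegA n q W) :=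
  WithLp.toLp 2 fun x => U (ψ x)

/-- The uniform state `ψ_t` after `t` queries:
`ψ_0 = q^{-n/2} ∑ x, |x⟩|0⟩` and `ψ_{t+1} = O U_t ψ_t`. -/
noncomputable def QueryAlgorithm.state (alg : QueryAlgorithm n q W) :
    ℕ → Joint (Inp n q) (RegA n q W)
  | 0 => WithLp.toLp 2 fun _ => (((Real.sqrt ((q : ℝ) ^ n))⁻¹ : ℝ) : ℂ) • alg.init
  | t + 1 => oracle (applyA (alg.U t) (alg.state t))

/-- The uniform state `ψ'_t = U_t ψ_t` just before the `(t+1)`-st query. -/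
noncomputable def QueryAlgorithm.state' (alg : QueryAlgorithm n q W) (t : ℕ) :
    Joint (Inp n q) (RegA n q W) :=
  applyA (alg.U t) (alg.state t)

end States

/-! ## The Fourier basis of `𝒳` -/

section Fourier

variable {n q : ℕ} [NeZero q]

/-- The vector `|χ_σ⟩ = ⨂ i, q^{-1/2} ∑ b, ω_q^{σ(i) b} |b⟩`. -/
noncomputable def chi (σ : Inp n q) : RegX n q :=
  WithLp.toLp 2 fun x =>
    ∏ i, ((((Real.sqrt q)⁻¹ : ℝ) : ℂ) * (ZMod.stdAddChar (σ i * x i) : ℂ))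

theorem orthonormal_chi : Orthonormal ℂ (chi : Inp n q → RegX n q) := by
  have hq : (q : ℂ) ≠ 0 := Nat.cast_ne_zero.2 (NeZero.ne q)
  have hs : (((Real.sqrt q)⁻¹ : ℝ) : ℂ) * (((Real.sqrt q)⁻¹ : ℝ) : ℂ) = (q : ℂ)⁻¹ := by
    rw [← Complex.ofReal_mul, ← mul_inv, Real.mul_self_sqrt (Nat.cast_nonneg q)]
    simp
  rw [orthonormal_iff_ite]
  intro σ τ
  have key : ∀ a b : ZMod q,
      ∑ x : ZMod q, ((((Real.sqrt q)⁻¹ : ℝ) : ℂ) * (ZMod.stdAddChar (b * x) : ℂ)) *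
        (starRingEnd ℂ) ((((Real.sqrt q)⁻¹ : ℝ) : ℂ) * (ZMod.stdAddChar (a * x) : ℂ))
      = if a = b then 1 else 0 := by
    intro a b
    have h1 : ∀ x : ZMod q, ((((Real.sqrt q)⁻¹ : ℝ) : ℂ) * (ZMod.stdAddChar (b * x) : ℂ)) *
        (starRingEnd ℂ) ((((Real.sqrt q)⁻¹ : ℝ) : ℂ) * (ZMod.stdAddChar (a * x) : ℂ))
        = (q : ℂ)⁻¹ * ZMod.stdAddChar (x * (b - a)) := by
      intro x
      rw [map_mul (starRingEnd ℂ), Complex.conj_ofReal, ← AddChar.map_neg_eq_conj,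
        mul_mul_mul_comm, hs,
        ← AddChar.map_add_eq_mul]
      congr 2
      ring
    simp_rw [h1]
    rw [← Finset.mul_sum, AddChar.sum_mulShift _ (ZMod.isPrimitive_stdAddChar q), ZMod.card]
    by_cases h : a = b
    · subst h
      simp [hq]
    · have : b - a ≠ 0 := fun h' => h (sub_eq_zero.1 h').symm
      simp [h, this]
  rw [PiLp.inner_apply]
  simp only [chi, RCLike.inner_apply, map_prod, ← Finset.prod_mul_distrib]
  rw [← Fintype.prod_sum (fun i (x : ZMod q) =>
    ((((Real.sqrt q)⁻¹ : ℝ) : ℂ) * (ZMod.stdAddChar (τ i * x) : ℂ)) *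
      (starRingEnd ℂ) ((((Real.sqrt q)⁻¹ : ℝ) : ℂ) * (ZMod.stdAddChar (σ i * x) : ℂ)))]
  simp_rw [key]
  rw [Fintype.prod_ite_zero]
  simp [funext_iff]

/-- The Fourier basis `(|χ_σ⟩)_σ` of `𝒳`. -/
noncomputable def fourierBasis (n q : ℕ) [NeZero q] :
    OrthonormalBasis (Inp n q) ℂ (RegX n q) :=
  OrthonormalBasis.mk (v := chi) orthonormal_chi
    (orthonormal_chi.linearIndependent.span_eq_top_of_card_eq_finrank' (by simp)).ge

theorem fourierBasis_apply (σ : Inp n q) : fourierBasis n q σ = chi σ := by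
  simp [fourierBasis]

/-- The support of `σ : [n] → ℤ_q`. -/
def supp (σ : Inp n q) : Finset (Fin n) := univ.filter fun i => σ i ≠ 0

end Fourier

/-! ## Partitions, inputs and knowledge -/

/-- Partitions of `[n]` into non-empty blocks. -/
abbrev Partition (n : ℕ) := Finpartition (univ : Finset (Fin n))

section Partitions

variable {n : ℕ}

/-- The number of `ℓ`-blocks of a partition. -/
def numBlocks (μ : Partition n) (l : ℕ) : ℕ := #{B ∈ μ.parts | #B = l}

/-- `μ` has exactly one `k`-block, and all its other blocks have size less than `k`. -/
def IsKDistinct (k : ℕ) (μ : Partition n) : Prop :=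
  numBlocks μ k = 1 ∧ ∀ B ∈ μ.parts, #B ≤ k

open Classical in
/-- The orbit `{π(μ) | π ∈ S_n}`, where `π` acts on each block elementwise. -/
noncomputable def orbit (μ : Partition n) : Finset (Partition n) :=
  univ.filter fun ν => ∃ π : Equiv.Perm (Fin n),
    ν.parts = μ.parts.image fun B => B.image π

/-- The knowledge system for finding `k` equal elements: `L⁺_μ` consists of the sets having at
least `k` elements in common with some block of `μ`.  If `μ` has a unique `k`-block and no larger
ones, these are precisely the supersets of the `k`-block. -/
def knowledge (k : ℕ) (μ : Partition n) : Set (Finset (Fin n)) :=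
  {S | ∃ B ∈ μ.parts, k ≤ #(S ∩ B)}

variable {q : ℕ} [NeZero q]

/-- The string `z^{↑μ}`: its `i`-th symbol is `z_B` for the block `B ∋ i`. -/
def lift (μ : Partition n) (z : μ.parts → ZMod q) : Inp n q :=
  fun i => z ⟨μ.part i, μ.part_mem.2 (mem_univ i)⟩

/-- The set `Y_μ` of inputs of type `μ` (in the relaxed version: `z` need not be injective). -/
noncomputable def inputs (q : ℕ) [NeZero q] (μ : Partition n) : Finset (Inp n q) :=
  univ.image (lift μ)

/-- The register `𝒴_μ`, with basis `|μ, y⟩` for `y ∈ Y_μ`. -/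
abbrev RegYμ (q : ℕ) [NeZero q] (μ : Partition n) := EuclideanSpace ℂ (inputs q μ)

/-- The register `𝒴`, with basis `|μ, y⟩` for `μ ∈ M` and `y ∈ Y_μ`. -/
abbrev RegY (q : ℕ) [NeZero q] (M : Finset (Partition n)) :=
  EuclideanSpace ℂ (Σ μ : M, inputs q μ.1)

/-- The transfer operator `Υ_μ : q^{-n/2} |x⟩ ↦ (p'_{μ,x})^{1/2} |μ, x⟩`, where `p'_{μ,x}` is
`1 / |Y_μ|` for `x ∈ Y_μ` and `0` otherwise. -/
noncomputable def transfer (μ : Partition n) : RegX n q →ₗ[ℂ] RegYμ q μ where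
  toFun φ := WithLp.toLp 2 fun y =>
    ((Real.sqrt ((q : ℝ) ^ n) * Real.sqrt (1 / (#(inputs q μ) : ℝ)) : ℝ) : ℂ) * φ y.1
  map_add' φ φ' := by
    ext y
    simp [mul_add]
  map_smul' a φ := by
    ext y
    simp [mul_left_comm]

open Classical in
/-- The knowledge operator `Υ^L_μ`, mapping `|χ_σ⟩` to `Υ_μ |χ_σ⟩` if `supp σ ∈ L`, and to `0`
otherwise. -/
noncomputable def knowledgeOpμ (L : Set (Finset (Fin n))) (μ : Partition n) :
    RegX n q →ₗ[ℂ] RegYμ q μ :=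
  (fourierBasis n q).toBasis.constr ℂ fun σ =>
    if supp σ ∈ L then transfer μ (chi σ) else 0

/-- The knowledge operator `φ ↦ ⨁_{μ ∈ M} (p_μ)^{1/2} Υ^{L_μ}_μ φ` of a collection `M` with the
uniform probability distribution `p_μ = 1 / |M|`. -/
noncomputable def knowledgeOp (L : Partition n → Set (Finset (Fin n)))
    (M : Finset (Partition n)) : RegX n q →ₗ[ℂ] RegY q M where
  toFun φ := WithLp.toLp 2 fun p =>
    ((Real.sqrt (1 / (#M : ℝ)) : ℝ) : ℂ) * knowledgeOpμ (L p.1.1) p.1.1 φ p.2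
  map_add' φ φ' := by
    ext p
    simp [mul_add]
  map_smul' a φ := by
    ext p
    simp [mul_left_comm]

/-- The vector `Υ⁺_k ψ` (that is, `(Υ⁺_k ⊗ I_𝒜) ψ`), for the collection `M` with its knowledge
system for finding `k` equal elements. -/
noncomputable def knowledgeState {W : Type*} [NormedAddCommGroup W] [InnerProductSpace ℂ W]
    (k : ℕ) (M : Finset (Partition n)) (ψ : Joint (Inp n q) (RegA n q W)) :
    Joint (Σ μ : M, inputs q μ.1) (RegA n q W) :=
  tensorId (RegA n q W) (knowledgeOp (knowledge k) M) ψ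

end Partitions

end KDist

/-! In the Fourier basis a query is a translation: a component querying `i` with phase `c` has `σ`
replaced by `σ + c·e_i`. On strings constant on the blocks of `μ`, `χ_σ` and `χ_τ` coincide up to
scaling exactly when `σ` and `τ` have the same block sums, so by Parseval (`sum_inputs_norm_sq`) the
transfer operator becomes `coarsen`, which adds up amplitudes with equal block sums. Averaging over
the orbit of `μ` is traded for a fixed `μ` and a state symmetrised over `S_n`. Thus `‖Υ⁺_k ψ‖²` is
the weight, after coarsening, of the strings with no zeros on the unique `k`-block `D`
(`norm_knowledgeState_sq`).

Unitaries preserve every weight. A query at `i ∉ D` does so too; a query at `i ∈ D` only affects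
strings where `σ i` is `0` or becomes `0`. Fixing `σ i` frees it from its block sum, so the change
is controlled by the weight of `D \ {i}` in the partition with `i` split off. Cauchy–Schwarz over
all components and all blocks of one size gives `sum_weight_query_sub_le`.

Let `W_l` be the total weight of the `l`-blocks and `N = cn`. Symmetry estimates both factors of the
increment of `W_l`. The weight querying a block already in the support is `O(1)`, since each index
shares its query weight with `N` equivalent blocks (`IsSymmetric.sum_blocks_weightAt_le`). The other
factor is the square root of a sum of `O(n)` terms, each at most `W_{l-1}/N²`: one factor `1/N`
because `D \ {i}` is one of `N` equivalent blocks, another because `i` is one of `N` equivalent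
singletons. Hence `W_l` grows by `O(√(W_{l-1}/n))` per query, and `W_1` by `O(1)`, so `W_l = O(T
(T/n)^{g_l})` with `g_1 = 0`, `g_{l+1} = (1 + g_l)/2` (`exists_blockWeight_le`).

For the single `k`-block the first factor is instead bounded by the norms themselves. Dividing by
them, the norm grows by `O(√W_{k-1}/n)` per query, which sums to the claimed bound
(`exists_sqrt_weight_le`). -/

namespace KDist

open Finset

/-! ### Block sums and splitting elements off a partition -/

section BlockSums

variable {n q : ℕ} {L L' : Type} [DecidableEq L] [DecidableEq L']

/-- The function assigning to `x` the sum of `σ` over the block of `x` in the partition of `[n]`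
into the fibres of `b`. -/
def blockSum (b : Fin n → L) (σ : Inp n q) : Inp n q :=
  fun x => ∑ y with b y = b x, σ y

theorem blockSum_add (b : Fin n → L) (σ τ : Inp n q) :
    blockSum b (σ + τ) = blockSum b σ + blockSum b τ := by
  ext x
  simp [blockSum, sum_add_distrib]

theorem blockSum_congr {b : Fin n → L} {b' : Fin n → L'}
    (h : ∀ x y, b x = b y ↔ b' x = b' y) :
    (blockSum b : Inp n q → Inp n q) = blockSum b' := by
  ext σ x
  simp [blockSum, h]

theorem blockSum_comp_perm (b : Fin n → L) (ρ : Equiv.Perm (Fin n)) (σ : Inp n q) :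
    blockSum (b ∘ ρ) (σ ∘ ρ) = blockSum b σ ∘ ρ := by
  ext x
  simp only [blockSum, Function.comp_apply, sum_filter]
  exact Equiv.sum_comp ρ (fun y => if b y = b (ρ x) then σ y else 0)

/-- The refinement of the partition `b` in which the elements of `A` become singletons. -/
def split (b : Fin n → L) (A : Finset (Fin n)) : Fin n → L ⊕ Fin n :=
  fun x => if x ∈ A then Sum.inr x else Sum.inl (b x)

theorem split_eq_split_iff (b : Fin n → L) (A : Finset (Fin n)) (x y : Fin n) :
    split b A x = split b A y ↔ x = y ∨ (x ∉ A ∧ y ∉ A ∧ b x = b y) := by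
  unfold split
  split_ifs <;> simp_all <;> grind

theorem blockSum_split_of_mem {b : Fin n → L} {A : Finset (Fin n)} (σ : Inp n q) {x : Fin n}
    (hx : x ∈ A) : blockSum (split b A) σ x = σ x := by
  have : (univ.filter fun y => split b A y = split b A x) = {x} := by
    ext y
    simp only [mem_filter, mem_univ, true_and, split_eq_split_iff, mem_singleton]
    grind
  simp [blockSum, this]

theorem blockSum_split_of_notMem {b : Fin n → L} {A : Finset (Fin n)} (σ : Inp n q) {x : Fin n}
    (hx : x ∉ A) :
    blockSum b σ x = blockSum (split b A) σ x + ∑ y ∈ A with b y = b x, σ y := by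
  have h1 : (univ.filter fun y => split b A y = split b A x)
      = univ.filter fun y => b y = b x ∧ y ∉ A := by
    ext y
    simp only [mem_filter, mem_univ, true_and, split_eq_split_iff]
    grind
  unfold blockSum
  rw [h1, ← sum_filter_add_sum_filter_not (univ.filter fun y => b y = b x) (fun y => y ∉ A),
    filter_filter, filter_filter]
  congr 2
  ext y
  simp [and_comm]

/-- On the strings with prescribed values on `A`, the sums over the blocks of `b` and over the
blocks of `split b A` determine each other. -/
theorem blockSum_eq_iff_split {b : Fin n → L} {A : Finset (Fin n)} {σ τ : Inp n q}
    (h : ∀ x ∈ A, σ x = τ x) :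
    blockSum b σ = blockSum b τ ↔ blockSum (split b A) σ = blockSum (split b A) τ := by
  have hA : ∀ x, ∑ y ∈ A with b y = b x, σ y = ∑ y ∈ A with b y = b x, τ y := fun x =>
    sum_congr rfl fun y hy => h y (mem_filter.1 hy).1
  constructor
  · intro e
    ext x
    by_cases hx : x ∈ A
    · rw [blockSum_split_of_mem σ hx, blockSum_split_of_mem τ hx, h x hx]
    · have := congrFun e x
      rw [blockSum_split_of_notMem σ hx, blockSum_split_of_notMem τ hx, hA] at this
      exact add_right_cancel this
  · intro e
    ext x
    by_cases hx : ∃ y, b y = b x ∧ y ∉ A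
    · obtain ⟨y, hy, hyA⟩ := hx
      have := congrFun e y
      have h2 : ∀ ρ : Inp n q, blockSum b ρ x = blockSum b ρ y := fun ρ => by simp [blockSum, hy]
      rw [h2, h2, blockSum_split_of_notMem σ hyA, blockSum_split_of_notMem τ hyA, hA, this]
    · push Not at hx
      exact sum_congr rfl fun y hy => h y (hx y (mem_filter.1 hy).2)

end BlockSums

/-! ### The transfer operator in Fourier space and its behaviour under one translation -/

section Coarsen

variable {n q : ℕ} [NeZero q] {L L' : Type} [DecidableEq L] [DecidableEq L']
variable {W : Type*} [NormedAddCommGroup W] [InnerProductSpace ℂ W]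

/-- The transfer operator of the partition `b` in the Fourier basis. -/
noncomputable def coarsen (b : Fin n → L) :
    (Inp n q → W) →ₗ[ℂ] PiLp 2 (fun _ : Inp n q => W) where
  toFun u := WithLp.toLp 2 fun τ => ∑ σ with blockSum b σ = τ, u σ
  map_add' u v := by
    ext τ
    simp [sum_add_distrib]
  map_smul' a u := by
    ext τ
    simp [smul_sum]

theorem norm_coarsen_sq (b : Fin n → L) (u : Inp n q → W) :
    ‖coarsen b u‖ ^ 2 = ∑ τ, ‖∑ σ with blockSum b σ = τ, u σ‖ ^ 2 := by
  rw [PiLp.norm_sq_eq_of_L2]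
  rfl

theorem coarsen_congr {b : Fin n → L} {b' : Fin n → L'}
    (h : ∀ x y, b x = b y ↔ b' x = b' y) :
    (coarsen b : (Inp n q → W) →ₗ[ℂ] _) = coarsen b' := by
  ext u τ
  simp [coarsen, blockSum_congr h]

/-- Block sums are additive, so a translation of the argument merely translates the vector of fibre
sums. This is why a query preserves the unrestricted norm. -/
theorem norm_coarsen_shift (b : Fin n → L) (d : Inp n q) (u : Inp n q → W) :
    ‖coarsen b fun σ => u (σ - d)‖ = ‖coarsen b u‖ := by
  refine (sq_eq_sq₀ (norm_nonneg _) (norm_nonneg _)).1 ?_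
  rw [norm_coarsen_sq, norm_coarsen_sq]
  refine Fintype.sum_equiv (Equiv.subRight (blockSum b d)) _ _ fun τ => ?_
  congr 2
  refine sum_equiv (Equiv.subRight d) (fun σ => ?_) fun σ _ => rfl
  simp only [mem_filter, mem_univ, true_and, Equiv.subRight_apply]
  have := blockSum_add b (σ - d) d
  rw [sub_add_cancel] at this
  rw [this, eq_sub_iff_add_eq]

theorem norm_coarsen_comp_perm (b : Fin n → L) (ρ : Equiv.Perm (Fin n)) (u : Inp n q → W) :
    ‖coarsen b fun σ => u (σ ∘ ρ)‖ = ‖coarsen (b ∘ ρ) u‖ := by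
  refine (sq_eq_sq₀ (norm_nonneg _) (norm_nonneg _)).1 ?_
  rw [norm_coarsen_sq, norm_coarsen_sq]
  let f : Inp n q ≃ Inp n q := Equiv.arrowCongr ρ.symm (Equiv.refl _)
  have hf : ∀ σ, f σ = σ ∘ ρ := fun σ => by ext x; simp [f, Equiv.arrowCongr]
  refine Fintype.sum_equiv f _ _ fun τ => ?_
  congr 2
  refine sum_equiv f (fun σ => ?_) fun σ _ => by rw [hf]
  simp only [mem_filter, mem_univ, true_and]
  rw [hf, hf, blockSum_comp_perm]
  exact ⟨fun h => by rw [h], fun h => ρ.surjective.injective_comp_right h⟩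

open Classical in
/-- Restricting to strings with prescribed values on `A` and coarsening to `b` has norm at most
that of coarsening to `split b A`. -/
theorem norm_coarsen_fix_le (b : Fin n → L) (A : Finset (Fin n)) (a : Inp n q)
    (u : Inp n q → W) :
    ‖coarsen b fun σ => if ∀ x ∈ A, σ x = a x then u σ else 0‖ ≤ ‖coarsen (split b A) u‖ := by
  refine (sq_le_sq₀ (norm_nonneg _) (norm_nonneg _)).1 ?_
  rw [norm_coarsen_sq, norm_coarsen_sq]
  set P : Inp n q → Prop := fun σ => ∀ x ∈ A, σ x = a x with hP
  set w : Inp n q → ℝ := fun τ => ‖∑ σ with blockSum (split b A) σ = τ, u σ‖ ^ 2 with hw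
  -- `g τ` is the vector of block sums for `split b A` of the strings satisfying `P` with `b`-block
  -- sums `τ`. It does not depend on the string; it is `0`, a value never used, when there is none.
  -- The left entries thus become distinct entries of the right-hand vector.
  have hex : ∀ τ : Inp n q, ∃ τ' : Inp n q, (∃ σ, P σ ∧ blockSum b σ = τ) →
      ∃ σ, P σ ∧ blockSum b σ = τ ∧ blockSum (split b A) σ = τ' := by
    intro τ
    by_cases h : ∃ σ, P σ ∧ blockSum b σ = τ
    · obtain ⟨σ, h1, h2⟩ := h
      exact ⟨_, fun _ => ⟨σ, h1, h2, rfl⟩⟩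
    · exact ⟨0, fun h' => (h h').elim⟩
  choose g hg using hex
  set I : Finset (Inp n q) := univ.filter fun τ => ∃ σ, P σ ∧ blockSum b σ = τ with hI
  have hsub : ∑ τ, ‖∑ σ with blockSum b σ = τ, (if P σ then u σ else 0)‖ ^ 2
      = ∑ τ ∈ I, w (g τ) := by
    rw [← sum_subset (subset_univ I)]
    · refine sum_congr rfl fun τ hτ => ?_
      obtain ⟨σ, h1, h2, h3⟩ := hg τ (mem_filter.1 hτ).2
      simp only [hw]
      congr 2
      rw [← sum_filter, filter_filter]
      refine sum_congr ?_ fun _ _ => rfl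
      ext ρ
      simp only [mem_filter, mem_univ, true_and]
      constructor
      · rintro ⟨h4, h5⟩
        rw [← h3, ← blockSum_eq_iff_split fun x hx => by rw [h5 x hx, h1 x hx], h4, h2]
      · intro h4
        have h5 : P ρ := fun x hx => by
          rw [← h1 x hx, ← blockSum_split_of_mem (b := b) ρ hx,
            ← blockSum_split_of_mem (b := b) σ hx, h4, h3]
        refine ⟨?_, h5⟩
        rw [← h2, blockSum_eq_iff_split fun x hx => by rw [h5 x hx, h1 x hx], h4, h3]
    · intro τ _ hτ
      have : ∑ σ with blockSum b σ = τ, (if P σ then u σ else 0) = 0 := by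
        refine sum_eq_zero fun σ hσ => if_neg fun h => hτ ?_
        exact mem_filter.2 ⟨mem_univ _, σ, h, (mem_filter.1 hσ).2⟩
      rw [this]
      simp
  have hinj : Set.InjOn g I := by
    intro τ hτ τ' hτ' h
    obtain ⟨σ, h1, h2, h3⟩ := hg τ (mem_filter.1 hτ).2
    obtain ⟨σ', h1', h2', h3'⟩ := hg τ' (mem_filter.1 hτ').2
    rw [← h2, ← h2', blockSum_eq_iff_split fun x hx => by rw [h1 x hx, h1' x hx], h3, h3', h]
  rw [hsub, ← sum_image hinj]
  exact sum_le_sum_of_subset_of_nonneg (subset_univ _) fun _ _ _ => sq_nonneg _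

open Classical in
/-- The restriction of `u` to the strings without zeros on `D`. -/
noncomputable def nonzeroOn (D : Finset (Fin n)) (u : Inp n q → W) : Inp n q → W :=
  fun σ => if ∀ x ∈ D, σ x ≠ 0 then u σ else 0

theorem nonzeroOn_empty (u : Inp n q → W) : nonzeroOn ∅ u = u := by
  ext σ
  simp [nonzeroOn]

theorem nonzeroOn_shift_of_notMem {D : Finset (Fin n)} {i : Fin n} (hi : i ∉ D) (c : ZMod q)
    (u : Inp n q → W) :
    nonzeroOn D (fun σ => u (σ - Pi.single i c))
      = fun σ => nonzeroOn D u (σ - Pi.single i c) := by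
  ext σ
  have : (∀ x ∈ D, σ x ≠ 0) ↔ ∀ x ∈ D, (σ - (Pi.single i c : Inp n q)) x ≠ 0 := by
    refine forall₂_congr fun x hx => ?_
    have : x ≠ i := fun h => hi (h ▸ hx)
    simp [this]
  simp only [nonzeroOn, this]

-- In the variable before the shift, the two restrictions differ only at `i`: `σ i ≠ -c` against `σ
-- i ≠ 0`. The difference of these indicators is that of `σ i = 0` minus that of `σ i = -c`.
open Classical in
theorem nonzeroOn_shift_sub {D : Finset (Fin n)} {i : Fin n} (hi : i ∈ D) (c : ZMod q)
    (u : Inp n q → W) :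
    nonzeroOn D (fun σ => u (σ - Pi.single i c)) - (fun σ => nonzeroOn D u (σ - Pi.single i c))
      = fun σ => ((fun σ => if ∀ x ∈ ({i} : Finset (Fin n)), σ x = (0 : Inp n q) x
            then nonzeroOn (D.erase i) u σ else 0)
          - (fun σ => if ∀ x ∈ ({i} : Finset (Fin n)), σ x = (Function.const _ (-c) : Inp n q) x
            then nonzeroOn (D.erase i) u σ else 0)) (σ - Pi.single i c) := by
  ext σ
  obtain ⟨σ, rfl⟩ : ∃ σ', σ = σ' + Pi.single i c := ⟨σ - Pi.single i c, by simp⟩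
  have h1 : ∀ τ : Inp n q, (∀ x ∈ D, τ x ≠ 0) ↔ (∀ x ∈ D.erase i, τ x ≠ 0) ∧ τ i ≠ 0 := by
    intro τ
    constructor
    · exact fun h => ⟨fun x hx => h x (mem_of_mem_erase hx), h i hi⟩
    · rintro ⟨h, h'⟩ x hx
      by_cases hxi : x = i
      · rwa [hxi]
      · exact h x (mem_erase.2 ⟨hxi, hx⟩)
  have h2 : (∀ x ∈ D.erase i, (σ + (Pi.single i c : Inp n q)) x ≠ 0) ↔ ∀ x ∈ D.erase i, σ x ≠ 0 := by
    refine forall₂_congr fun x hx => ?_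
    simp [ne_of_mem_erase hx]
  have h3 : (σ + (Pi.single i c : Inp n q)) i = σ i + c := by simp
  have h4 : σ i + c = 0 ↔ σ i = -c := eq_neg_iff_add_eq_zero.symm
  simp only [nonzeroOn, Pi.sub_apply (fun _ : Inp n q => _), mem_singleton,
    forall_eq, Pi.zero_apply, Function.const_apply]
  rw [add_sub_cancel_right]
  simp only [h1, h2, h3, ne_eq, h4]
  by_cases hP : ∀ x ∈ D.erase i, ¬ σ x = 0
  · simp only [eq_true hP, true_and, if_true]
    split_ifs <;> first | contradiction | simp
  · simp only [eq_false hP, false_and, if_false, ite_self]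

theorem norm_coarsen_nonzeroOn_shift_of_notMem (b : Fin n → L) {D : Finset (Fin n)} {i : Fin n}
    (hi : i ∉ D) (c : ZMod q) (u : Inp n q → W) :
    ‖coarsen b (nonzeroOn D fun σ => u (σ - Pi.single i c))‖ = ‖coarsen b (nonzeroOn D u)‖ := by
  rw [nonzeroOn_shift_of_notMem hi, norm_coarsen_shift]

/-- Difference of squares, then the triangle inequality; the factor `2` counts the two exceptional
values `0` and `-c` at `i`. The sum of norms is kept because it is estimated differently for blocks
smaller than `k` and for the `k`-block. -/
theorem norm_coarsen_nonzeroOn_shift_sq_sub_le (b : Fin n → L) {D : Finset (Fin n)} {i : Fin n}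
    (hi : i ∈ D) (c : ZMod q) (u : Inp n q → W) :
    ‖coarsen b (nonzeroOn D fun σ => u (σ - Pi.single i c))‖ ^ 2
        - ‖coarsen b (nonzeroOn D u)‖ ^ 2
      ≤ (‖coarsen b (nonzeroOn D fun σ => u (σ - Pi.single i c))‖
          + ‖coarsen b (nonzeroOn D u)‖)
        * (2 * ‖coarsen (split b {i}) (nonzeroOn (D.erase i) u)‖) := by
  rw [← norm_coarsen_shift b (Pi.single i c) (nonzeroOn D u), sq_sub_sq]
  refine mul_le_mul_of_nonneg_left ?_ (by positivity)
  refine (norm_sub_norm_le _ _).trans ?_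
  rw [← map_sub, nonzeroOn_shift_sub hi, norm_coarsen_shift, map_sub, two_mul]
  exact (norm_sub_le _ _).trans
    (add_le_add (norm_coarsen_fix_le _ _ _ _) (norm_coarsen_fix_le _ _ _ _))

-- Inclusion–exclusion, from expanding `∏ (1 - [σ x = 0])`. It trades the nonzero condition for
-- prescribed zeros, which `norm_coarsen_fix_le` can absorb into the partition.
open Classical in
theorem nonzeroOn_eq_sum (D : Finset (Fin n)) (u : Inp n q → W) :
    nonzeroOn D u = ∑ A ∈ D.powerset, (-1 : ℂ) ^ #A •
      fun σ => if ∀ x ∈ A, σ x = (0 : Inp n q) x then u σ else 0 := by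
  ext σ
  have h1 : nonzeroOn D u σ = (∏ x ∈ D, (1 - if σ x = 0 then (1 : ℂ) else 0)) • u σ := by
    have : ∀ x, (1 - if σ x = 0 then (1 : ℂ) else 0) = if σ x ≠ 0 then 1 else 0 := by
      intro x
      by_cases h : σ x = 0 <;> simp [h]
    simp_rw [this, prod_ite_zero]
    simp [nonzeroOn, ite_smul]
  rw [h1, prod_sub]
  simp only [Finset.sum_apply, Pi.smul_apply, sum_smul]
  refine sum_congr rfl fun A _ => ?_
  rw [prod_ite_zero]
  by_cases h : ∀ x ∈ A, σ x = 0 <;> simp [h]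

theorem norm_coarsen_nonzeroOn_le (b : Fin n → L) (D : Finset (Fin n)) (u : Inp n q → W) :
    ‖coarsen b (nonzeroOn D u)‖ ≤ ∑ A ∈ D.powerset, ‖coarsen (split b A) u‖ := by
  classical
  rw [nonzeroOn_eq_sum, map_sum]
  refine (norm_sum_le _ _).trans (sum_le_sum fun A _ => ?_)
  rw [map_smul, norm_smul]
  simpa using norm_coarsen_fix_le b A 0 u

theorem norm_coarsen_nonzeroOn_comp_perm (b : Fin n → L) (D : Finset (Fin n))
    (ρ : Equiv.Perm (Fin n)) (u : Inp n q → W) :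
    ‖coarsen b (nonzeroOn (D.map ρ.toEmbedding) fun σ => u (σ ∘ ρ))‖
      = ‖coarsen (b ∘ ρ) (nonzeroOn D u)‖ := by
  rw [← norm_coarsen_comp_perm b ρ (nonzeroOn D u)]
  congr 2
  ext σ
  have : (∀ x ∈ D.map ρ.toEmbedding, σ x ≠ 0) ↔ ∀ x ∈ D, (σ ∘ ρ) x ≠ 0 := forall_mem_map
  simp only [nonzeroOn, this]

end Coarsen

/-! ### Blocks of a partition, their survival under splitting, and automorphisms -/

section Blocks

variable {n : ℕ} {L L' : Type} [DecidableEq L] [DecidableEq L']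

/-- The blocks of size `l` of the partition of `[n]` into the fibres of `b`. -/
def blocks (b : Fin n → L) (l : ℕ) : Finset (Finset (Fin n)) :=
  (univ.image fun x => univ.filter fun y => b y = b x).filter fun D => #D = l

theorem mem_blocks {b : Fin n → L} {l : ℕ} {D : Finset (Fin n)} :
    D ∈ blocks b l ↔ (∃ x, ∀ y, y ∈ D ↔ b y = b x) ∧ #D = l := by
  simp [blocks, Finset.ext_iff, eq_comm]

theorem mem_iff_of_mem_blocks {b : Fin n → L} {l : ℕ} {D : Finset (Fin n)}
    (hD : D ∈ blocks b l) {x : Fin n} (hx : x ∈ D) (y : Fin n) : y ∈ D ↔ b y = b x := by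
  obtain ⟨⟨z, hz⟩, -⟩ := mem_blocks.1 hD
  rw [hz, (hz x).1 hx]

theorem card_of_mem_blocks {b : Fin n → L} {l : ℕ} {D : Finset (Fin n)}
    (hD : D ∈ blocks b l) : #D = l :=
  (mem_blocks.1 hD).2

theorem nonempty_of_mem_blocks {b : Fin n → L} {l : ℕ} {D : Finset (Fin n)}
    (hD : D ∈ blocks b l) : D.Nonempty := by
  obtain ⟨⟨z, hz⟩, -⟩ := mem_blocks.1 hD
  exact ⟨z, (hz z).2 rfl⟩

theorem eq_of_mem_blocks {b : Fin n → L} {l l' : ℕ} {D D' : Finset (Fin n)}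
    (hD : D ∈ blocks b l) (hD' : D' ∈ blocks b l') {x : Fin n} (hx : x ∈ D) (hx' : x ∈ D') :
    D = D' := by
  ext y
  rw [mem_iff_of_mem_blocks hD hx, mem_iff_of_mem_blocks hD' hx']

theorem singleton_mem_blocks {b : Fin n → L} {j : Fin n} :
    {j} ∈ blocks b 1 ↔ ∀ y, b y = b j → y = j := by
  constructor
  · intro h y hy
    simpa using (mem_iff_of_mem_blocks h (mem_singleton_self j) y).2 hy
  · intro h
    refine mem_blocks.2 ⟨⟨j, fun y => ?_⟩, card_singleton j⟩
    rw [mem_singleton]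
    exact ⟨fun e => e ▸ rfl, h y⟩

theorem card_blocks_mul_le (b : Fin n → L) (l : ℕ) : #(blocks b l) * l ≤ n := by
  have h : #((blocks b l).biUnion id) = ∑ D ∈ blocks b l, #D := by
    refine card_biUnion fun D hD D' hD' hne => ?_
    refine disjoint_left.2 fun x hx hx' => hne (eq_of_mem_blocks hD hD' hx hx')
  rw [sum_congr rfl fun D hD => card_of_mem_blocks hD, sum_const, smul_eq_mul] at h
  rw [← h]
  exact (card_le_univ _).trans (by simp)

/-- Blocks disjoint from `A` survive in `split b A`. -/
theorem mem_blocks_split {b : Fin n → L} {l : ℕ} {D A : Finset (Fin n)} (hD : D ∈ blocks b l)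
    (hA : Disjoint D A) : D ∈ blocks (split b A) l := by
  obtain ⟨x, hx⟩ := nonempty_of_mem_blocks hD
  refine mem_blocks.2 ⟨⟨x, fun y => ?_⟩, card_of_mem_blocks hD⟩
  rw [split_eq_split_iff, mem_iff_of_mem_blocks hD hx]
  have h1 : x ∉ A := disjoint_left.1 hA hx
  have h2 : b y = b x → y ∉ A := fun h =>
    disjoint_left.1 hA ((mem_iff_of_mem_blocks hD hx y).2 h)
  grind

theorem sdiff_mem_blocks_split {b : Fin n → L} {l : ℕ} {D A : Finset (Fin n)}
    (hD : D ∈ blocks b l) (hA : A ⊆ D) {x : Fin n} (hx : x ∈ D) (hxA : x ∉ A) :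
    D \ A ∈ blocks (split b A) (l - #A) := by
  refine mem_blocks.2 ⟨⟨x, fun y => ?_⟩, by rw [card_sdiff_of_subset hA, card_of_mem_blocks hD]⟩
  rw [split_eq_split_iff, mem_sdiff, mem_iff_of_mem_blocks hD hx]
  grind

theorem singleton_mem_blocks_split (b : Fin n → L) {A : Finset (Fin n)} {x : Fin n}
    (hx : x ∈ A) : {x} ∈ blocks (split b A) 1 := by
  rw [singleton_mem_blocks]
  intro y hy
  rw [split_eq_split_iff] at hy
  grind

theorem erase_mem_blocks_split {b : Fin n → L} {l : ℕ} {D : Finset (Fin n)}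
    (hD : D ∈ blocks b l) (hl : 2 ≤ l) {j : Fin n} (hj : j ∈ D) :
    D.erase j ∈ blocks (split b {j}) (l - 1) := by
  have : 1 < #D := by rw [card_of_mem_blocks hD]; lia
  obtain ⟨x, hx, hxj⟩ := exists_mem_ne this j
  rw [← sdiff_singleton_eq_erase]
  simpa using sdiff_mem_blocks_split hD (singleton_subset_iff.2 hj) hx (by simpa using hxj)

/-- Splitting within an `l`-block does not decrease the number of `m`-blocks for `m < l`. -/
theorem blocks_subset_blocks_split {b : Fin n → L} {l m : ℕ} {D A : Finset (Fin n)}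
    (hD : D ∈ blocks b l) (hA : A ⊆ D) (hm : m < l) : blocks b m ⊆ blocks (split b A) m := by
  intro E hE
  refine mem_blocks_split hE (disjoint_left.2 fun x hxE hxA => ?_)
  have := eq_of_mem_blocks hD hE (hA hxA) hxE
  have h1 := card_of_mem_blocks hD
  have h2 := card_of_mem_blocks hE
  subst this
  lia

/-- After splitting a subset of an `l`-block `D` into singletons, each element of `D` lies in a
block whose size `m ≤ l` is such that there are no fewer `m`-blocks than before. -/
theorem exists_mem_blocks_split {b : Fin n → L} {l : ℕ} {D A : Finset (Fin n)}
    (hD : D ∈ blocks b l) (hA : A ⊆ D) {j : Fin n} (hj : j ∈ D) :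
    ∃ m, 1 ≤ m ∧ m ≤ l ∧ (∃ E ∈ blocks (split b A) m, j ∈ E)
      ∧ blocks b m ⊆ blocks (split b A) m := by
  have hl := card_of_mem_blocks hD
  have hpos : 0 < #D := card_pos.2 ⟨j, hj⟩
  by_cases hjA : j ∈ A
  · refine ⟨1, le_rfl, by lia, ⟨{j}, singleton_mem_blocks_split b hjA, by simp⟩, ?_⟩
    -- For `l = 1` the block `D` itself has the size being counted, so the survival lemma for
    -- strictly smaller blocks does not apply; here splitting a singleton changes nothing.
    by_cases h1 : l = 1
    · subst h1
      obtain ⟨x, rfl⟩ := card_eq_one.1 hl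
      have hjx : j = x := by simpa using hj
      subst hjx
      intro E hE
      by_cases hjE : j ∈ E
      · rw [← eq_of_mem_blocks hD hE hj hjE]
        exact singleton_mem_blocks_split b hjA
      · refine mem_blocks_split hE (disjoint_left.2 fun y hyE hyA => hjE ?_)
        have := hA hyA
        simp only [mem_singleton] at this
        exact this ▸ hyE
    · exact blocks_subset_blocks_split hD hA (by lia)
  · have hAl : #A < l := by
      rw [← hl]
      exact card_lt_card ((ssubset_iff_of_subset hA).2 ⟨j, hj, hjA⟩)
    refine ⟨l - #A, by lia, by lia, ⟨_, sdiff_mem_blocks_split hD hA hj hjA, by simp [hj, hjA]⟩,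
      ?_⟩
    obtain rfl | hne := A.eq_empty_or_nonempty
    · exact fun E hE => mem_blocks_split hE (disjoint_empty_right _)
    · exact blocks_subset_blocks_split hD hA (by have := card_pos.2 hne; lia)

/-- Any two blocks of the same size are exchanged by an automorphism of the partition. -/
theorem exists_perm_of_mem_blocks {b : Fin n → L} {l : ℕ} {D D' : Finset (Fin n)}
    (hD : D ∈ blocks b l) (hD' : D' ∈ blocks b l) :
    ∃ ρ : Equiv.Perm (Fin n), D.map ρ.toEmbedding = D' ∧
      ∀ x y, b (ρ x) = b (ρ y) ↔ b x = b y := by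
  by_cases hne : D = D'
  · exact ⟨Equiv.refl _, by simp [hne], fun x y => by simp⟩
  have hdisj : ∀ x ∈ D, x ∉ D' := fun x hx hx' => hne (eq_of_mem_blocks hD hD' hx hx')
  obtain ⟨g⟩ : Nonempty (D ≃ D') := ⟨Finset.equivOfCardEq
    ((card_of_mem_blocks hD).trans (card_of_mem_blocks hD').symm)⟩
  -- The involution exchanging `D` and `D'` along a bijection and fixing everything else.
  let f : Fin n → Fin n := fun x =>
    if hx : x ∈ D then g ⟨x, hx⟩ else if hx' : x ∈ D' then g.symm ⟨x, hx'⟩ else x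
  have f1 : ∀ x (hx : x ∈ D), f x = g ⟨x, hx⟩ := fun x hx => by simp [f, hx]
  have f2 : ∀ x (hx : x ∈ D'), f x = g.symm ⟨x, hx⟩ := fun x hx => by
    have : x ∉ D := fun h => hdisj x h hx
    simp [f, hx, this]
  have f3 : ∀ x, x ∉ D → x ∉ D' → f x = x := fun x hx hx' => by simp [f, hx, hx']
  have m1 : ∀ x ∈ D, f x ∈ D' := fun x hx => by rw [f1 x hx]; exact (g _).2
  have m2 : ∀ x ∈ D', f x ∈ D := fun x hx => by rw [f2 x hx]; exact (g.symm _).2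
  have hf : Function.Involutive f := by
    intro x
    by_cases hx : x ∈ D
    · rw [f2 _ (m1 x hx)]
      simp [f1 x hx]
    · by_cases hx' : x ∈ D'
      · rw [f1 _ (m2 x hx')]
        simp [f2 x hx']
      · rw [f3 x hx hx', f3 x hx hx']
  have key : ∀ x y, b x = b y → b (f x) = b (f y) := by
    intro x y hxy
    by_cases hx : x ∈ D
    · have hy := (mem_iff_of_mem_blocks hD hx y).2 hxy.symm
      exact ((mem_iff_of_mem_blocks hD' (m1 y hy) (f x)).1 (m1 x hx))
    · by_cases hx' : x ∈ D'
      · have hy := (mem_iff_of_mem_blocks hD' hx' y).2 hxy.symm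
        exact ((mem_iff_of_mem_blocks hD (m2 y hy) (f x)).1 (m2 x hx'))
      · have hy : y ∉ D := fun h => hx ((mem_iff_of_mem_blocks hD h x).2 hxy)
        have hy' : y ∉ D' := fun h => hx' ((mem_iff_of_mem_blocks hD' h x).2 hxy)
        rw [f3 x hx hx', f3 y hy hy', hxy]
  refine ⟨hf.toPerm, ?_, fun x y => ⟨fun h => ?_, key x y⟩⟩
  · ext x
    simp only [mem_map_equiv, Function.Involutive.toPerm_symm, Function.Involutive.coe_toPerm]
    exact ⟨fun h => by have := m1 _ h; rwa [hf x] at this, m2 x⟩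
  · have := key _ _ h
    simpa [hf _] using this

end Blocks

/-! ### Weights of symmetric families -/

section Families

variable {n q : ℕ} [NeZero q] {L L' : Type} [DecidableEq L] [DecidableEq L']
variable {W : Type*} [NormedAddCommGroup W] [InnerProductSpace ℂ W]
variable {ι : Type*} [Fintype ι]

/-- The squared norm of the part of the family `Φ` that is about to query `j`, restricted to
strings without zeros on `D` and coarsened to `b`. -/
noncomputable def weightAt (idx : ι → Fin n) (Φ : ι → Inp n q → W) (b : Fin n → L)
    (D : Finset (Fin n)) (j : Fin n) : ℝ :=
  ∑ x with idx x = j, ‖coarsen b (nonzeroOn D (Φ x))‖ ^ 2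

/-- The squared norm of the family `Φ`, restricted to strings without zeros on `D` and coarsened
to `b`. -/
noncomputable def weight (Φ : ι → Inp n q → W) (b : Fin n → L) (D : Finset (Fin n)) : ℝ :=
  ∑ x, ‖coarsen b (nonzeroOn D (Φ x))‖ ^ 2

/-- The total weight over all `l`-blocks. -/
noncomputable def blockWeight (Φ : ι → Inp n q → W) (b : Fin n → L) (l : ℕ) : ℝ :=
  ∑ D ∈ blocks b l, weight Φ b D

/-- Invariance of a family under the symmetric group on `[n]`. -/
def IsSymmetric (idx : ι → Fin n) (Φ : ι → Inp n q → W) : Prop :=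
  ∀ ρ : Equiv.Perm (Fin n), ∃ κ : Equiv.Perm ι,
    ∀ x, idx (κ x) = ρ (idx x) ∧ Φ (κ x) = fun σ => Φ x (σ ∘ ρ)

variable {idx : ι → Fin n} {Φ : ι → Inp n q → W}

theorem weightAt_nonneg (b : Fin n → L) (D : Finset (Fin n)) (j : Fin n) :
    0 ≤ weightAt idx Φ b D j :=
  sum_nonneg fun _ _ => sq_nonneg _

theorem weight_nonneg (b : Fin n → L) (D : Finset (Fin n)) : 0 ≤ weight Φ b D :=
  sum_nonneg fun _ _ => sq_nonneg _

theorem sum_weightAt (b : Fin n → L) (D : Finset (Fin n)) :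
    ∑ j, weightAt idx Φ b D j = weight Φ b D :=
  sum_fiberwise _ _ _

theorem sum_weightAt_le (b : Fin n → L) (D J : Finset (Fin n)) :
    ∑ j ∈ J, weightAt idx Φ b D j ≤ weight Φ b D := by
  rw [← sum_weightAt (idx := idx)]
  exact sum_le_sum_of_subset_of_nonneg (subset_univ _) fun _ _ _ => weightAt_nonneg _ _ _

theorem weightAt_congr {b : Fin n → L} {b' : Fin n → L'} (h : ∀ x y, b x = b y ↔ b' x = b' y)
    (D : Finset (Fin n)) (j : Fin n) : weightAt idx Φ b D j = weightAt idx Φ b' D j := by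
  simp only [weightAt, coarsen_congr h]

theorem IsSymmetric.weightAt_map (hΦ : IsSymmetric idx Φ) {b : Fin n → L}
    {ρ : Equiv.Perm (Fin n)} (hρ : ∀ x y, b (ρ x) = b (ρ y) ↔ b x = b y)
    (D : Finset (Fin n)) (j : Fin n) :
    weightAt idx Φ b (D.map ρ.toEmbedding) (ρ j) = weightAt idx Φ b D j := by
  obtain ⟨κ, hκ⟩ := hΦ ρ
  refine (sum_equiv κ (fun x => ?_) fun x _ => ?_).symm
  · simp [(hκ x).1]
  · rw [(hκ x).2, norm_coarsen_nonzeroOn_comp_perm, coarsen_congr (b := b ∘ ρ) (b' := b) hρ]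

theorem IsSymmetric.weight_map (hΦ : IsSymmetric idx Φ) {b : Fin n → L}
    {ρ : Equiv.Perm (Fin n)} (hρ : ∀ x y, b (ρ x) = b (ρ y) ↔ b x = b y)
    (D : Finset (Fin n)) : weight Φ b (D.map ρ.toEmbedding) = weight Φ b D := by
  rw [← sum_weightAt (idx := idx), ← sum_weightAt (idx := idx)]
  exact (Fintype.sum_equiv ρ _ _ fun j => (hΦ.weightAt_map hρ D j).symm).symm

/-- Blocks of equal size are exchanged by automorphisms of the partition, so they all carry the same
weight. -/
theorem IsSymmetric.card_blocks_mul_weight (hΦ : IsSymmetric idx Φ) {b : Fin n → L} {l : ℕ}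
    {D : Finset (Fin n)} (hD : D ∈ blocks b l) :
    (#(blocks b l) : ℝ) * weight Φ b D = blockWeight Φ b l := by
  rw [blockWeight, ← nsmul_eq_mul, ← sum_const]
  refine sum_congr rfl fun D' hD' => ?_
  obtain ⟨ρ, rfl, h⟩ := exists_perm_of_mem_blocks hD hD'
  exact (hΦ.weight_map h D).symm

/-- Transporting `j` by automorphisms gives one index in each block of this size with the same query
weight. These indices are distinct, so their query weights add up to at most the total. -/
theorem IsSymmetric.card_blocks_mul_weightAt_le (hΦ : IsSymmetric idx Φ) {b : Fin n → L} {l : ℕ}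
    {D : Finset (Fin n)} (hD : D ∈ blocks b l) {j : Fin n} (hj : j ∈ D) :
    (#(blocks b l) : ℝ) * weightAt idx Φ b ∅ j ≤ weight Φ b ∅ := by
  have : ∀ D', ∃ j', D' ∈ blocks b l →
      j' ∈ D' ∧ weightAt idx Φ b ∅ j' = weightAt idx Φ b ∅ j := by
    intro D'
    by_cases hD' : D' ∈ blocks b l
    · obtain ⟨ρ, rfl, h⟩ := exists_perm_of_mem_blocks hD hD'
      exact ⟨ρ j, fun _ => ⟨by simpa using hj, by simpa using hΦ.weightAt_map h ∅ j⟩⟩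
    · exact ⟨j, fun h => (hD' h).elim⟩
  choose f hf using this
  have hinj : Set.InjOn f (blocks b l) := fun D₁ h₁ D₂ h₂ h =>
    eq_of_mem_blocks h₁ h₂ (hf D₁ h₁).1 (h ▸ (hf D₂ h₂).1)
  refine le_trans (le_of_eq ?_) (sum_weightAt_le (idx := idx) b ∅ ((blocks b l).image f))
  rw [sum_image hinj, sum_congr rfl fun D' hD' => (hf D' hD').2, sum_const, nsmul_eq_mul]

/-- Swapping two singleton blocks outside `D` is an automorphism fixing `D`, so all indices of `J`
are queried with equal weight. -/
theorem IsSymmetric.card_mul_weightAt_le (hΦ : IsSymmetric idx Φ) {b : Fin n → L}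
    {D J : Finset (Fin n)} (hJ : ∀ i ∈ J, i ∉ D ∧ {i} ∈ blocks b 1) {j : Fin n} (hj : j ∈ J) :
    (#J : ℝ) * weightAt idx Φ b D j ≤ weight Φ b D := by
  refine le_trans (le_of_eq ?_) (sum_weightAt_le (idx := idx) b D J)
  rw [← nsmul_eq_mul, ← sum_const]
  refine sum_congr rfl fun i hi => ?_
  have h1 := singleton_mem_blocks.1 (hJ i hi).2
  have h2 := singleton_mem_blocks.1 (hJ j hj).2
  have hρ : ∀ x y, b (Equiv.swap j i x) = b (Equiv.swap j i y) ↔ b x = b y := by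
    intro x y
    simp only [Equiv.swap_apply_def]
    grind
  have := hΦ.weightAt_map hρ D j
  rw [Equiv.swap_apply_left] at this
  rw [← this]
  congr 1
  ext x
  rw [mem_map_equiv, Equiv.symm_swap]
  have h3 := (hJ i hi).1
  have h4 := (hJ j hj).1
  simp only [Equiv.swap_apply_def]
  grind

end Families

/-! ### The effect of one query on block weights -/

section Step

variable {n q : ℕ} [NeZero q] {L : Type} [DecidableEq L]
variable {W : Type*} [NormedAddCommGroup W] [InnerProductSpace ℂ W]
variable {ι : Type*} [Fintype ι] {idx : ι → Fin n} {Φ Φ' : ι → Inp n q → W}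

/-- Inclusion–exclusion followed by Cauchy–Schwarz over the `2 ^ #D` subsets. -/
theorem weightAt_le_sum_split (b : Fin n → L) (D : Finset (Fin n)) (j : Fin n) :
    weightAt idx Φ b D j
      ≤ 2 ^ #D * ∑ A ∈ D.powerset, weightAt idx Φ (split b A) ∅ j := by
  unfold weightAt
  rw [sum_comm, mul_sum]
  refine sum_le_sum fun x _ => ?_
  simp only [nonzeroOn_empty]
  refine (pow_le_pow_left₀ (norm_nonneg _) (norm_coarsen_nonzeroOn_le b D (Φ x)) 2).trans ?_
  refine sq_sum_le_card_mul_sum_sq.trans (le_of_eq ?_)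
  simp

/-- The weight that the family puts on querying a block all of whose elements are already in the
support is bounded. -/
theorem IsSymmetric.sum_blocks_weightAt_le (hΦ : IsSymmetric idx Φ) {b : Fin n → L} {l : ℕ}
    (h1 : ∀ A, weight Φ (split b A) ∅ ≤ 1) {N : ℝ}
    (hN : ∀ m, 1 ≤ m → m ≤ l → N ≤ #(blocks b m)) :
    N * ∑ D ∈ blocks b l, ∑ j ∈ D, weightAt idx Φ b D j ≤ n * 4 ^ l := by
  have key : ∀ D ∈ blocks b l, ∀ j ∈ D, N * weightAt idx Φ b D j ≤ 4 ^ l := by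
    intro D hD j hj
    have h2 : ∀ A ∈ D.powerset, N * weightAt idx Φ (split b A) ∅ j ≤ 1 := by
      intro A hA
      obtain ⟨m, hm1, hml, ⟨E, hE, hjE⟩, hsub⟩ :=
        exists_mem_blocks_split hD (mem_powerset.1 hA) hj
      refine (mul_le_mul_of_nonneg_right ((hN m hm1 hml).trans ?_)
        (weightAt_nonneg _ _ _)).trans
        ((hΦ.card_blocks_mul_weightAt_le hE hjE).trans (h1 A))
      exact_mod_cast card_le_card hsub
    -- For negative `N` the left-hand side is nonpositive.
    have hN0 : 0 ≤ N ∨ N < 0 := le_or_gt 0 N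
    rcases hN0 with hN0 | hN0
    · calc N * weightAt idx Φ b D j
          ≤ N * (2 ^ #D * ∑ A ∈ D.powerset, weightAt idx Φ (split b A) ∅ j) :=
            mul_le_mul_of_nonneg_left (weightAt_le_sum_split b D j) hN0
        _ = 2 ^ l * ∑ A ∈ D.powerset, N * weightAt idx Φ (split b A) ∅ j := by
            rw [card_of_mem_blocks hD, ← mul_sum]
            ring
        _ ≤ 2 ^ l * ∑ A ∈ D.powerset, 1 :=
            mul_le_mul_of_nonneg_left (sum_le_sum h2) (by positivity)
        _ = 4 ^ l := by
            rw [sum_const, card_powerset, card_of_mem_blocks hD]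
            simp only [nsmul_eq_mul, mul_one, Nat.cast_pow, Nat.cast_ofNat]
            rw [← mul_pow]
            norm_num
    · exact (mul_nonpos_of_nonpos_of_nonneg hN0.le (weightAt_nonneg _ _ _)).trans (by positivity)
  simp_rw [mul_sum]
  calc _ ≤ ∑ D ∈ blocks b l, ∑ j ∈ D, (4 : ℝ) ^ l :=
        sum_le_sum fun D hD => sum_le_sum fun j hj => key D hD j hj
    _ = ((#(blocks b l) * l : ℕ) : ℝ) * 4 ^ l := by
        rw [sum_congr rfl fun D hD => by rw [sum_const, card_of_mem_blocks hD], sum_const]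
        simp [mul_assoc]
    _ ≤ _ := mul_le_mul_of_nonneg_right (by exact_mod_cast card_blocks_mul_le b l)
        (by positivity)

/-- One factor `N` comes from the singletons, among which `j` now is one, being equally likely to be
queried. The other comes from `D.erase j` being one of at least `N` equivalent `(l - 1)`-blocks. -/
theorem IsSymmetric.sq_mul_weightAt_erase_le (hΦ : IsSymmetric idx Φ) {b : Fin n → L} {l : ℕ}
    (hl : 2 ≤ l) {N : ℝ} (hN0 : 0 ≤ N) (hN1 : N ≤ #(blocks b 1))
    (hNl : N ≤ #(blocks b (l - 1))) {D : Finset (Fin n)} (hD : D ∈ blocks b l) {j : Fin n}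
    (hj : j ∈ D) :
    N ^ 2 * weightAt idx Φ (split b {j}) (D.erase j) j
      ≤ blockWeight Φ (split b {j}) (l - 1) := by
  classical
  set J : Finset (Fin n) := insert j (univ.filter fun i => {i} ∈ blocks b 1) with hJdef
  have hJ : ∀ i ∈ J, i ∉ D.erase j ∧ {i} ∈ blocks (split b {j}) 1 := by
    intro i hi
    rcases mem_insert.1 hi with rfl | hi
    · exact ⟨notMem_erase _ _, singleton_mem_blocks_split b (mem_singleton_self _)⟩
    · have hi' := (mem_filter.1 hi).2
      have hiD : i ∉ D := by
        intro h
        have h1 := eq_of_mem_blocks hD hi' h (mem_singleton_self i)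
        have h2 := card_of_mem_blocks hD
        rw [h1, card_singleton] at h2
        lia
      refine ⟨fun h => hiD (mem_of_mem_erase h), mem_blocks_split hi' ?_⟩
      rw [disjoint_singleton]
      rintro rfl
      exact hiD hj
  have hJN : N ≤ #J := by
    refine hN1.trans ?_
    have : blocks b 1 ⊆ J.image fun i => {i} := by
      intro E hE
      obtain ⟨i, rfl⟩ := card_eq_one.1 (card_of_mem_blocks hE)
      exact mem_image.2 ⟨i, mem_insert_of_mem (mem_filter.2 ⟨mem_univ _, hE⟩), rfl⟩
    exact_mod_cast (card_le_card this).trans card_image_le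
  have hsub : #(blocks b (l - 1)) ≤ #(blocks (split b {j}) (l - 1)) :=
    card_le_card (blocks_subset_blocks_split hD (singleton_subset_iff.2 hj) (by lia))
  calc N ^ 2 * weightAt idx Φ (split b {j}) (D.erase j) j
      = N * (N * weightAt idx Φ (split b {j}) (D.erase j) j) := by ring
    _ ≤ N * weight Φ (split b {j}) (D.erase j) :=
        mul_le_mul_of_nonneg_left ((mul_le_mul_of_nonneg_right hJN (weightAt_nonneg _ _ _)).trans
          (hΦ.card_mul_weightAt_le hJ (mem_insert_self _ _))) hN0
    _ ≤ #(blocks (split b {j}) (l - 1)) * weight Φ (split b {j}) (D.erase j) :=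
        mul_le_mul_of_nonneg_right (hNl.trans (by exact_mod_cast hsub)) (weight_nonneg _ _)
    _ = _ := hΦ.card_blocks_mul_weight (erase_mem_blocks_split hD hl hj)

/-- The base case of the recursion: splitting a singleton does nothing and erasing its element
leaves no condition, so the sum is a part of the total query weight. -/
theorem sum_blocks_one_weightAt_erase_le (b : Fin n → L) :
    ∑ D ∈ blocks b 1, ∑ j ∈ D, weightAt idx Φ (split b {j}) (D.erase j) j ≤ weight Φ b ∅ := by
  have h1 : ∀ D ∈ blocks b 1, ∑ j ∈ D, weightAt idx Φ (split b {j}) (D.erase j) j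
      = ∑ j ∈ D, weightAt idx Φ b ∅ j := by
    intro D hD
    obtain ⟨i, rfl⟩ := card_eq_one.1 (card_of_mem_blocks hD)
    rw [sum_singleton, sum_singleton, erase_singleton]
    refine weightAt_congr (fun x y => ?_) _ _
    have := singleton_mem_blocks.1 hD
    rw [split_eq_split_iff]
    simp only [mem_singleton]
    grind
  rw [sum_congr rfl h1, ← sum_biUnion]
  · exact sum_weightAt_le _ _ _
  · exact fun D hD D' hD' hne =>
      disjoint_left.2 fun x hx hx' => hne (eq_of_mem_blocks hD hD' hx hx')

theorem sum_weightAt_eq (b : Fin n → L) (D : Finset (Fin n)) :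
    ∑ j ∈ D, weightAt idx Φ b D j
      = ∑ x with idx x ∈ D, ‖coarsen b (nonzeroOn D (Φ x))‖ ^ 2 := by
  rw [← sum_fiberwise_of_maps_to (s := univ.filter fun x => idx x ∈ D) (t := D) (g := idx)
    (fun x hx => (mem_filter.1 hx).2)]
  refine sum_congr rfl fun j hj => sum_congr ?_ fun _ _ => rfl
  ext x
  simp only [mem_filter, mem_univ, true_and]
  grind

/-- The effect of one query on the weight of a collection of sets. -/
theorem sum_weight_query_sub_le {ph : ι → ZMod q}
    (hq : ∀ x σ, Φ' x σ = Φ x (σ - Pi.single (idx x) (ph x))) (b : Fin n → L)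
    (𝒟 : Finset (Finset (Fin n))) :
    ∑ D ∈ 𝒟, weight Φ' b D - ∑ D ∈ 𝒟, weight Φ b D
      ≤ (√(∑ D ∈ 𝒟, ∑ j ∈ D, weightAt idx Φ' b D j)
          + √(∑ D ∈ 𝒟, ∑ j ∈ D, weightAt idx Φ b D j))
        * (2 * √(∑ D ∈ 𝒟, ∑ j ∈ D, weightAt idx Φ (split b {j}) (D.erase j) j)) := by
  have hq' : ∀ x, Φ' x = fun σ => Φ x (σ - Pi.single (idx x) (ph x)) := fun x => funext (hq x)
  let K' : Finset (Fin n) × ι → ℝ := fun p => ‖coarsen b (nonzeroOn p.1 (Φ' p.2))‖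
  let K : Finset (Fin n) × ι → ℝ := fun p => ‖coarsen b (nonzeroOn p.1 (Φ p.2))‖
  let Z : Finset (Fin n) × ι → ℝ := fun p =>
    ‖coarsen (split b {idx p.2}) (nonzeroOn (p.1.erase (idx p.2)) (Φ p.2))‖
  -- Only pairs whose queried index lies in the block contribute; the weight of all other pairs is
  -- unchanged.
  let s : Finset (Finset (Fin n) × ι) := (𝒟 ×ˢ univ).filter fun p => idx p.2 ∈ p.1
  have hs : ∀ F : Finset (Fin n) × ι → ℝ,
      ∑ p ∈ s, F p = ∑ D ∈ 𝒟, ∑ x with idx x ∈ D, F (D, x) := by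
    intro F
    simp only [s, sum_filter]
    rw [sum_product]
  have h1 : ∑ D ∈ 𝒟, weight Φ' b D - ∑ D ∈ 𝒟, weight Φ b D
      ≤ ∑ p ∈ s, (K' p + K p) * (2 * Z p) := by
    rw [hs, ← sum_sub_distrib]
    refine sum_le_sum fun D _ => ?_
    rw [weight, weight, ← sum_sub_distrib, sum_filter]
    refine sum_le_sum fun x _ => ?_
    rw [hq' x]
    split_ifs with hx
    · have := norm_coarsen_nonzeroOn_shift_sq_sub_le b hx (ph x) (Φ x)
      simpa only [K', K, Z, hq' x] using this
    · rw [norm_coarsen_nonzeroOn_shift_of_notMem b hx, sub_self]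
  have hK' : ∑ D ∈ 𝒟, ∑ j ∈ D, weightAt idx Φ' b D j = ∑ p ∈ s, K' p ^ 2 := by
    simp only [hs, sum_weightAt_eq, K']
  have hK : ∑ D ∈ 𝒟, ∑ j ∈ D, weightAt idx Φ b D j = ∑ p ∈ s, K p ^ 2 := by
    simp only [hs, sum_weightAt_eq, K]
  have hZ : ∑ D ∈ 𝒟, ∑ j ∈ D, weightAt idx Φ (split b {j}) (D.erase j) j
      = ∑ p ∈ s, Z p ^ 2 := by
    rw [hs]
    refine sum_congr rfl fun D _ => ?_
    rw [← sum_fiberwise_of_maps_to (s := univ.filter fun x => idx x ∈ D) (t := D) (g := idx)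
      (fun x hx => (mem_filter.1 hx).2)]
    refine sum_congr rfl fun j hj => ?_
    rw [weightAt]
    have : (univ.filter fun x => idx x ∈ D).filter (fun x => idx x = j)
        = univ.filter fun x => idx x = j := by
      ext x
      simp only [mem_filter, mem_univ, true_and]
      grind
    rw [this]
    refine sum_congr rfl fun x hx => ?_
    simp only [Z, (mem_filter.1 hx).2]
  rw [hK', hK, hZ]
  refine h1.trans ?_
  have h2 : ∀ p, (K' p + K p) * (2 * Z p) = 2 * (K' p * Z p) + 2 * (K p * Z p) := fun p => by
    ring
  simp_rw [h2, sum_add_distrib, ← mul_sum]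
  have h3 := Real.sum_mul_le_sqrt_mul_sqrt s K' Z
  have h4 := Real.sum_mul_le_sqrt_mul_sqrt s K Z
  linarith

end Step

/-! ### The recursion over queries and block sizes -/

section Runs

variable {n q : ℕ} [NeZero q] {L : Type} [DecidableEq L]
variable {W : Type*} [NormedAddCommGroup W] [InnerProductSpace ℂ W]
variable {ι : Type} [Fintype ι] {idx : ι → Fin n}

/-- The uniform states of a query algorithm in the Fourier basis, symmetrised over `S_n` and
decomposed into components `x : ι` querying `idx x` with phase `ph x`. -/
structure IsRun (idx : ι → Fin n) (ph : ι → ZMod q) (Φ Φ' : ℕ → ι → Inp n q → W) : Prop where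
  init : ∀ x σ, σ ≠ 0 → Φ 0 x σ = 0
  norm_init : ∑ x, ‖Φ 0 x 0‖ ^ 2 ≤ 1
  symm : ∀ t, IsSymmetric idx (Φ t)
  symm' : ∀ t, IsSymmetric idx (Φ' t)
  unitary : ∀ t (L : Type) [DecidableEq L] (b : Fin n → L) (D : Finset (Fin n)),
    weight (Φ' t) b D = weight (Φ t) b D
  query : ∀ t x σ, Φ (t + 1) x σ = Φ' t x (σ - Pi.single (idx x) (ph x))

variable {ph : ι → ZMod q} {Φ Φ' : ℕ → ι → Inp n q → W}

/-- Initially only `σ = 0` has amplitude, so coarsening adds up nothing; afterwards unitaries and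
translations preserve the norm. -/
theorem IsRun.weight_empty_le (h : IsRun idx ph Φ Φ') (t : ℕ) (b : Fin n → L) :
    weight (Φ t) b ∅ ≤ 1 := by
  induction t with
  | zero =>
    refine le_trans (le_of_eq (sum_congr rfl fun x _ => ?_)) h.norm_init
    rw [nonzeroOn_empty, norm_coarsen_sq, Fintype.sum_eq_single (blockSum b (0 : Inp n q))]
    · rw [sum_eq_single_of_mem 0 (by simp) fun σ _ hσ => h.init x σ hσ]
    · intro τ hτ
      rw [sum_eq_zero, norm_zero, zero_pow two_ne_zero]
      intro σ hσ
      refine h.init x σ fun hσ0 => hτ ?_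
      rw [← (mem_filter.1 hσ).2, hσ0]
  | succ t ih =>
    refine le_trans (le_of_eq (sum_congr rfl fun x _ => ?_)) ((h.unitary t L b ∅).trans_le ih)
    rw [nonzeroOn_empty, nonzeroOn_empty, funext (h.query t x), norm_coarsen_shift]

theorem IsRun.weight_zero (h : IsRun idx ph Φ Φ') (b : Fin n → L) {D : Finset (Fin n)}
    (hD : D.Nonempty) : weight (Φ 0) b D = 0 := by
  refine sum_eq_zero fun x _ => ?_
  have : nonzeroOn D (Φ 0 x) = 0 := by
    ext σ
    obtain ⟨i, hi⟩ := hD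
    simp only [nonzeroOn, Pi.zero_apply, ite_eq_right_iff]
    intro hσ
    exact h.init x σ fun h0 => hσ i hi (by rw [h0]; rfl)
  rw [this, map_zero, norm_zero, zero_pow two_ne_zero]

theorem IsSymmetric.sum_weightAt_erase_le {Φ : ι → Inp n q → W} (hΦ : IsSymmetric idx Φ)
    {b : Fin n → L} {l : ℕ} (hl : 2 ≤ l) {N : ℝ} (hN0 : 0 < N) (hN1 : N ≤ #(blocks b 1))
    (hNl : N ≤ #(blocks b (l - 1))) {D : Finset (Fin n)} (hD : D ∈ blocks b l) {B : ℝ}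
    (hB : ∀ j ∈ D, blockWeight Φ (split b {j}) (l - 1) ≤ B) :
    ∑ j ∈ D, weightAt idx Φ (split b {j}) (D.erase j) j ≤ l * (B / N ^ 2) := by
  calc _ ≤ ∑ j ∈ D, B / N ^ 2 := sum_le_sum fun j hj => by
        rw [le_div_iff₀ (by positivity), mul_comm]
        exact (hΦ.sq_mul_weightAt_erase_le hl hN0.le hN1 hNl hD hj).trans (hB j hj)
    _ = _ := by rw [sum_const, card_of_mem_blocks hD, nsmul_eq_mul]

/-- Summation of the one-query increments: each of the two first square roots is at most `√(4 ^ l /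
c)`, and with the factor `2` on the last one this gives `4`. -/
theorem IsRun.blockWeight_le_mul (h : IsRun idx ph Φ Φ') {b : Fin n → L} {l : ℕ}
    {c : ℝ} (hc : 0 < c) (hn : 0 < n) (hb : ∀ m, 1 ≤ m → m ≤ l → c * n ≤ #(blocks b m)) {Z : ℝ}
    {T : ℕ} (hZ : ∀ t < T,
      ∑ D ∈ blocks b l, ∑ j ∈ D, weightAt idx (Φ' t) (split b {j}) (D.erase j) j ≤ Z) :
    blockWeight (Φ T) b l ≤ T * (4 * √(4 ^ l / c) * √Z) := by
  have hn' : (0 : ℝ) < n := Nat.cast_pos.2 hn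
  have hG : ∀ Ψ : ι → Inp n q → W, IsSymmetric idx Ψ →
      (∀ A, weight Ψ (split b A) ∅ ≤ 1) →
      ∑ D ∈ blocks b l, ∑ j ∈ D, weightAt idx Ψ b D j ≤ 4 ^ l / c := by
    intro Ψ hΨ h1
    have := hΨ.sum_blocks_weightAt_le h1 hb
    rw [le_div_iff₀ hc]
    refine le_of_mul_le_mul_left ?_ hn'
    linarith
  induction T with
  | zero =>
    simp only [blockWeight, Nat.cast_zero, zero_mul]
    exact (sum_eq_zero fun D hD => h.weight_zero b (nonempty_of_mem_blocks hD)).le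
  | succ T ih =>
    have h1 := sum_weight_query_sub_le (h.query T) b (blocks b l)
    have h2 : ∑ D ∈ blocks b l, weight (Φ' T) b D = blockWeight (Φ T) b l :=
      sum_congr rfl fun D _ => h.unitary T L b D
    rw [h2] at h1
    have g1 := Real.sqrt_le_sqrt (hG _ (h.symm (T + 1)) fun A => h.weight_empty_le (T + 1) _)
    have g2 := Real.sqrt_le_sqrt (hG _ (h.symm' T) fun A => by
      rw [h.unitary]
      exact h.weight_empty_le T _)
    have g3 := Real.sqrt_le_sqrt (hZ T (Nat.lt_succ_self T))
    have h3 := h1.trans (mul_le_mul (add_le_add g1 g2)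
      (mul_le_mul_of_nonneg_left g3 zero_le_two) (by positivity) (by positivity))
    have h4 := ih fun t ht => hZ t (ht.trans (Nat.lt_succ_self T))
    rw [← blockWeight] at h3
    push_cast
    linarith

/-- The exponents of the growth rates of the block weights. -/
noncomputable def growthExp (l : ℕ) : ℝ := 1 - 2 * (1 / 2) ^ l

theorem growthExp_one : growthExp 1 = 0 := by norm_num [growthExp]

theorem growthExp_succ (l : ℕ) : growthExp (l + 1) = (1 + growthExp l) / 2 := by
  simp only [growthExp]
  ring

theorem growthExp_nonneg {l : ℕ} (hl : 1 ≤ l) : 0 ≤ growthExp l := by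
  induction l, hl using Nat.le_induction with
  | base => rw [growthExp_one]
  | succ l _ ih =>
    rw [growthExp_succ]
    linarith

theorem sqrt_mul_rpow_growthExp {x : ℝ} (hx : 0 < x) (l : ℕ) :
    √(x * x ^ growthExp l) = x ^ growthExp (l + 1) := by
  have h : x * x ^ growthExp l = x ^ (1 + growthExp l) := by
    rw [Real.rpow_add hx, Real.rpow_one]
  rw [growthExp_succ, h, Real.sqrt_eq_rpow, ← Real.rpow_mul hx.le]
  ring_nf

theorem mul_rpow_growthExp_le {s T : ℕ} (hs : s ≤ T) (n : ℕ) {l : ℕ} (hl : 1 ≤ l) :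
    (s : ℝ) / n * ((s : ℝ) / n) ^ growthExp l ≤ (T : ℝ) / n * ((T : ℝ) / n) ^ growthExp l := by
  have : (s : ℝ) / n ≤ T / n := by gcongr
  have h0 : (0 : ℝ) ≤ s / n := by positivity
  exact mul_le_mul this (Real.rpow_le_rpow h0 this (growthExp_nonneg hl)) (by positivity)
    (h0.trans this)

theorem exists_blockWeight_le {c : ℝ} (hc : 0 < c) {l : ℕ} (hl : 1 ≤ l) :
    ∃ C : ℝ, 0 < C ∧ ∀ (n q : ℕ) [NeZero q] (W : Type*) [NormedAddCommGroup W]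
      [InnerProductSpace ℂ W] (ι : Type) [Fintype ι] (idx : ι → Fin n) (ph : ι → ZMod q)
      (Φ Φ' : ℕ → ι → Inp n q → W), IsRun idx ph Φ Φ' → 0 < n →
      ∀ (L : Type) [DecidableEq L] (b : Fin n → L),
        (∀ m, 1 ≤ m → m ≤ l → c * n ≤ #(blocks b m)) →
        ∀ T : ℕ, blockWeight (Φ T) b l ≤ C * (T * ((T : ℝ) / n) ^ growthExp l) := by
  induction l, hl using Nat.le_induction with
  | base =>
    refine ⟨4 * √(4 ^ 1 / c), by positivity, ?_⟩
    intro n q _ W _ _ ι _ idx ph Φ Φ' h hn L _ b hb T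
    have := h.blockWeight_le_mul hc hn hb (Z := 1) (T := T) fun t _ =>
      (sum_blocks_one_weightAt_erase_le b).trans
        ((h.unitary t L b ∅).trans_le (h.weight_empty_le t b))
    rw [growthExp_one, Real.rpow_zero]
    simp only [Real.sqrt_one, mul_one] at this ⊢
    linarith
  | succ l hl ih =>
    obtain ⟨C, hC, ih⟩ := ih
    refine ⟨4 * √(4 ^ (l + 1) / c) * √(C / c ^ 2), by positivity, ?_⟩
    intro n q _ W _ _ ι _ idx ph Φ Φ' h hn L _ b hb T
    have hn' : (0 : ℝ) < n := Nat.cast_pos.2 hn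
    set x : ℝ := (T : ℝ) / n with hx
    have hZ : ∀ t < T, ∑ D ∈ blocks b (l + 1), ∑ j ∈ D,
        weightAt idx (Φ' t) (split b {j}) (D.erase j) j
          ≤ C / c ^ 2 * (x * x ^ growthExp l) := by
      intro t ht
      have hB : ∀ D ∈ blocks b (l + 1), ∀ j ∈ D, blockWeight (Φ' t) (split b {j}) (l + 1 - 1)
          ≤ C * (t * ((t : ℝ) / n) ^ growthExp l) := by
        intro D hD j hj
        have : blockWeight (Φ' t) (split b {j}) (l + 1 - 1)
            = blockWeight (Φ t) (split b {j}) l :=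
          sum_congr rfl fun D _ => h.unitary t _ _ D
        rw [this]
        -- Splitting `j` off an `(l + 1)`-block destroys no block of size at most `l`, so the
        -- induction hypothesis applies with the same `c`.
        refine ih n q W ι idx ph Φ Φ' h hn _ _ (fun m h1 h2 => (hb m h1 (by lia)).trans ?_) t
        exact_mod_cast card_le_card
          (blocks_subset_blocks_split hD (singleton_subset_iff.2 hj) (by lia))
      calc _ ≤ ∑ D ∈ blocks b (l + 1),
              (l + 1 : ℕ) * (C * (t * ((t : ℝ) / n) ^ growthExp l) / (c * n) ^ 2) :=
            sum_le_sum fun D hD => (h.symm' t).sum_weightAt_erase_le (by lia)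
              (by positivity) (hb 1 le_rfl (by lia)) (hb _ (by lia) (by lia)) hD (hB D hD)
        _ = ((#(blocks b (l + 1)) * (l + 1) : ℕ) : ℝ)
              * (C * (t * ((t : ℝ) / n) ^ growthExp l) / (c * n) ^ 2) := by
            rw [sum_const]
            push_cast
            ring
        _ ≤ n * (C * (t * ((t : ℝ) / n) ^ growthExp l) / (c * n) ^ 2) :=
            mul_le_mul_of_nonneg_right (by exact_mod_cast card_blocks_mul_le b (l + 1))
              (by positivity)
        _ = C / c ^ 2 * ((t : ℝ) / n * ((t : ℝ) / n) ^ growthExp l) := by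
            field_simp
        _ ≤ _ := mul_le_mul_of_nonneg_left (mul_rpow_growthExp_le ht.le n hl) (by positivity)
    have h1 := h.blockWeight_le_mul hc hn hb hZ
    obtain rfl | hT := T.eq_zero_or_pos
    · simpa using h1
    · have hx0 : 0 < x := by positivity
      rw [Real.sqrt_mul (by positivity), sqrt_mul_rpow_growthExp hx0] at h1
      linarith

/-- With only one `k`-block there is no abundance of `k`-blocks to exploit, so the query weight on
`D` is bounded by the whole weight of `D`. The recursion is then linear in the norm. -/
theorem exists_sqrt_weight_le {c : ℝ} (hc : 0 < c) {k : ℕ} (hk : 2 ≤ k) :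
    ∃ C : ℝ, 0 < C ∧ ∀ (n q : ℕ) [NeZero q] (W : Type*) [NormedAddCommGroup W]
      [InnerProductSpace ℂ W] (ι : Type) [Fintype ι] (idx : ι → Fin n) (ph : ι → ZMod q)
      (Φ Φ' : ℕ → ι → Inp n q → W), IsRun idx ph Φ Φ' → 0 < n →
      ∀ (L : Type) [DecidableEq L] (b : Fin n → L),
        (∀ m, 1 ≤ m → m ≤ k - 1 → c * n ≤ #(blocks b m)) → ∀ D ∈ blocks b k,
        ∀ T : ℕ, √(weight (Φ T) b D) ≤ C * (T * (((T : ℝ) / n) ^ growthExp k / √n)) := by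
  obtain ⟨l, rfl⟩ : ∃ l, k = l + 1 := ⟨k - 1, by lia⟩
  have hl : 1 ≤ l := by lia
  obtain ⟨C, hC, hbw⟩ := exists_blockWeight_le hc hl
  refine ⟨2 * √((l + 1 : ℕ) * (C / c ^ 2)), by positivity, ?_⟩
  intro n q _ W _ _ ι _ idx ph Φ Φ' h hn L _ b hb D hD T
  have hn' : (0 : ℝ) < n := Nat.cast_pos.2 hn
  obtain rfl | hT := T.eq_zero_or_pos
  · rw [h.weight_zero b (nonempty_of_mem_blocks hD)]
    simp
  set x : ℝ := (T : ℝ) / n with hx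
  have hx0 : 0 < x := by positivity
  -- The square root of `k · W_{k-1} / (c n)²`, where `W_{k-1} ≤ C T x ^ growthExp (k - 1)`.
  set δ : ℝ := √((l + 1 : ℕ) * (C / c ^ 2)) * (x ^ growthExp (l + 1) / √n) with hδ
  have hZ : ∀ t < T, √(∑ j ∈ D, weightAt idx (Φ' t) (split b {j}) (D.erase j) j) ≤ δ := by
    intro t ht
    have hB : ∀ j ∈ D, blockWeight (Φ' t) (split b {j}) (l + 1 - 1)
        ≤ C * (t * ((t : ℝ) / n) ^ growthExp l) := by
      intro j hj
      have : blockWeight (Φ' t) (split b {j}) (l + 1 - 1)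
          = blockWeight (Φ t) (split b {j}) l :=
        sum_congr rfl fun D _ => h.unitary t _ _ D
      rw [this]
      refine hbw n q W ι idx ph Φ Φ' h hn _ _ (fun m h1 h2 => (hb m h1 (by lia)).trans ?_) t
      exact_mod_cast card_le_card
        (blocks_subset_blocks_split hD (singleton_subset_iff.2 hj) (by lia))
    have h1 : ∑ j ∈ D, weightAt idx (Φ' t) (split b {j}) (D.erase j) j
        ≤ (l + 1 : ℕ) * (C / c ^ 2) * (x * x ^ growthExp l / n) := by
      calc _ ≤ (l + 1 : ℕ) * (C * (t * ((t : ℝ) / n) ^ growthExp l) / (c * n) ^ 2) :=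
            (h.symm' t).sum_weightAt_erase_le hk (by positivity) (hb 1 le_rfl (by lia))
              (hb _ (by lia) (by lia)) hD hB
        _ = (l + 1 : ℕ) * (C / c ^ 2) * ((t : ℝ) / n * ((t : ℝ) / n) ^ growthExp l / n) := by
            field_simp
        _ ≤ _ := by
            gcongr ?_ * (?_ / _)
            exact mul_rpow_growthExp_le ht.le n hl
    refine (Real.sqrt_le_sqrt h1).trans (le_of_eq ?_)
    rw [Real.sqrt_mul (by positivity), Real.sqrt_div (by positivity),
      sqrt_mul_rpow_growthExp hx0]
  have key : ∀ t ≤ T, √(weight (Φ t) b D) ≤ t * (2 * δ) := by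
    intro t
    induction t with
    | zero =>
      intro _
      rw [h.weight_zero b (nonempty_of_mem_blocks hD)]
      simp
    | succ t ih =>
      intro ht
      have h1 := sum_weight_query_sub_le (h.query t) b {D}
      simp only [sum_singleton] at h1
      have h2 := ih (by lia)
      have h3 := hZ t (by lia)
      have h4 : √(∑ j ∈ D, weightAt idx (Φ (t + 1)) b D j) ≤ √(weight (Φ (t + 1)) b D) :=
        Real.sqrt_le_sqrt (sum_weightAt_le _ _ _)
      have h5 : √(∑ j ∈ D, weightAt idx (Φ' t) b D j) ≤ √(weight (Φ t) b D) :=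
        Real.sqrt_le_sqrt ((sum_weightAt_le _ _ _).trans (h.unitary t L b D).le)
      rw [h.unitary] at h1
      have h6 := h1.trans (mul_le_mul (add_le_add h4 h5)
        (mul_le_mul_of_nonneg_left h3 zero_le_two) (by positivity) (by positivity))
      -- Cancel the sum of the two norms from a difference of squares; if the claim failed, that sum
      -- would be positive.
      have h7 : √(weight (Φ (t + 1)) b D) - √(weight (Φ t) b D) ≤ 2 * δ := by
        have e1 := Real.sq_sqrt (weight_nonneg (Φ := Φ (t + 1)) b D)
        have e2 := Real.sq_sqrt (weight_nonneg (Φ := Φ t) b D)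
        have e3 := Real.sqrt_nonneg (weight (Φ (t + 1)) b D)
        have e4 := Real.sqrt_nonneg (weight (Φ t) b D)
        have e5 : 0 ≤ δ := by positivity
        by_contra! hlt
        have e6 : 0 < √(weight (Φ (t + 1)) b D) + √(weight (Φ t) b D) := by linarith
        have := mul_lt_mul_of_pos_left hlt e6
        nlinarith
      push_cast
      linarith
  have := key T le_rfl
  rw [hδ] at this
  linarith

/-- The exponents are `1 + growthExp k = (2 ^ k - 1) / 2 ^ (k - 1)` for `t` and `growthExp k + 1/2 =
(3 * 2 ^ (k - 2) - 1) / 2 ^ (k - 1)` for `n`. -/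
theorem mul_rpow_growthExp_eq {k : ℕ} (hk : 2 ≤ k) (t : ℕ) {n : ℕ} (hn : 0 < n) :
    t * (((t : ℝ) / n) ^ growthExp k / √n)
      = ((t : ℝ) ^ (2 ^ k - 1) / (n : ℝ) ^ (3 * 2 ^ (k - 2) - 1)) ^ ((1 : ℝ) / 2 ^ (k - 1)) := by
  have hn' : (0 : ℝ) < n := Nat.cast_pos.2 hn
  obtain ⟨m, rfl⟩ : ∃ m, k = m + 2 := ⟨k - 2, by lia⟩
  have h1 : 1 ≤ 2 ^ (m + 2) := Nat.one_le_two_pow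
  have h2 : 1 ≤ 3 * 2 ^ m := by have := Nat.one_le_two_pow (n := m); lia
  simp only [Nat.add_sub_cancel, show m + 2 - 1 = m + 1 from rfl]
  obtain rfl | ht := t.eq_zero_or_pos
  · have : 2 ^ (m + 2) - 1 ≠ 0 := by
      have := Nat.one_lt_two_pow (n := m + 2) (by lia)
      lia
    rw [Nat.cast_zero, zero_mul, zero_pow this, zero_div, Real.zero_rpow (by positivity)]
  have ht' : (0 : ℝ) < t := Nat.cast_pos.2 ht
  rw [← Real.rpow_natCast, ← Real.rpow_natCast, Real.div_rpow ht'.le hn'.le,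
    Real.div_rpow (by positivity) (by positivity), ← Real.rpow_mul ht'.le, ← Real.rpow_mul hn'.le,
    Real.sqrt_eq_rpow, div_div, ← Real.rpow_add hn', ← mul_div_assoc,
    ← Real.rpow_one_add' ht'.le]
  · congr 2
    · rw [Nat.cast_sub h1]
      simp only [growthExp, one_div, inv_pow]
      push_cast
      field_simp
      ring
    · rw [Nat.cast_sub h2]
      simp only [growthExp, one_div, inv_pow]
      push_cast
      field_simp
      ring
  · have := growthExp_nonneg (l := m + 2) (by lia)
    linarith

end Runs

/-! ### Fourier expansion of the uniform states -/

section FourierStates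

variable {n q : ℕ} [NeZero q] {W : Type*} [NormedAddCommGroup W] [InnerProductSpace ℂ W]

/-- The uniform state `ψ_t` in the Fourier basis. -/
noncomputable def QueryAlgorithm.fourierState (alg : QueryAlgorithm n q W) :
    ℕ → Inp n q → RegA n q W
  | 0 => fun σ => if σ = 0 then alg.init else 0
  | t + 1 => fun σ => WithLp.toLp 2 fun ic =>
      alg.U t (alg.fourierState t (σ - Pi.single ic.1 ic.2)) ic

theorem chi_apply (σ x : Inp n q) :
    (chi σ).ofLp x = (((√((q : ℝ) ^ n))⁻¹ : ℝ) : ℂ) * (ZMod.stdAddChar (∑ i, σ i * x i) : ℂ) := by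
  have h : √((q : ℝ) ^ n) = √(q : ℝ) ^ n := by
    rw [Real.sqrt_eq_iff_eq_sq (by positivity) (by positivity), ← pow_mul, mul_comm n 2, pow_mul,
      Real.sq_sqrt (Nat.cast_nonneg q)]
  simp only [chi, prod_mul_distrib, prod_const, card_univ, Fintype.card_fin, h]
  rw [← inv_pow, Complex.ofReal_pow]
  congr 1
  symm
  induction (univ : Finset (Fin n)) using Finset.cons_induction with
  | empty => simp
  | cons i s hi ih => rw [sum_cons, prod_cons, AddChar.map_add_eq_mul, ih]

theorem stdAddChar_mul_chi (i : Fin n) (c : ZMod q) (σ x : Inp n q) :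
    (ZMod.stdAddChar (c * x i) : ℂ) * (chi σ).ofLp x = (chi (σ + Pi.single i c)).ofLp x := by
  have h : ∑ j, (σ + Pi.single i c : Inp n q) j * x j = c * x i + ∑ j, σ j * x j := by
    simp only [Pi.add_apply, add_mul, sum_add_distrib]
    rw [add_comm, sum_eq_single i]
    · simp
    · intro j _ hj
      simp [hj]
    · simp
  rw [chi_apply, chi_apply, h, AddChar.map_add_eq_mul]
  ring

theorem QueryAlgorithm.state_apply (alg : QueryAlgorithm n q W) (t : ℕ) (x : Inp n q) :
    (alg.state t).ofLp x = ∑ σ, (chi σ).ofLp x • alg.fourierState t σ := by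
  induction t with
  | zero =>
    simp only [state, fourierState, smul_ite, smul_zero]
    rw [sum_ite_eq' univ (0 : Inp n q)]
    simp [chi_apply]
  | succ t ih =>
    ext ic
    have h1 : ((alg.state (t + 1)).ofLp x).ofLp ic
        = (ZMod.stdAddChar (ic.2 * x ic.1) : ℂ) • (alg.U t ((alg.state t).ofLp x)).ofLp ic := rfl
    rw [h1, ih, map_sum, WithLp.ofLp_sum, Finset.sum_apply, WithLp.ofLp_sum, Finset.sum_apply,
      smul_sum]
    refine Fintype.sum_equiv (Equiv.addRight (Pi.single ic.1 ic.2)) _ _ fun σ => ?_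
    rw [map_smul, PiLp.smul_apply, PiLp.smul_apply, smul_smul, stdAddChar_mul_chi]
    simp [fourierState]

theorem QueryAlgorithm.state'_apply (alg : QueryAlgorithm n q W) (t : ℕ) (x : Inp n q) :
    (alg.state' t).ofLp x = ∑ σ, (chi σ).ofLp x • alg.U t (alg.fourierState t σ) := by
  have h1 : (alg.state' t).ofLp x = alg.U t ((alg.state t).ofLp x) := rfl
  rw [h1, alg.state_apply, map_sum]
  simp_rw [map_smul]

end FourierStates

/-! ### Characters and Parseval's identity on inputs of a given type -/

section Parseval

variable {n q : ℕ} [NeZero q]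

theorem mem_inputs {μ : Partition n} {y : Inp n q} :
    y ∈ inputs q μ ↔ ∀ i j, μ.part i = μ.part j → y i = y j := by
  constructor
  · intro h i j hij
    obtain ⟨z, -, rfl⟩ := mem_image.1 h
    simp only [lift]
    congr 1
    exact Subtype.ext hij
  · intro h
    have hne : ∀ B : μ.parts, B.1.Nonempty := fun B => μ.nonempty_of_mem_parts B.2
    refine mem_image.2 ⟨fun B => y (hne B).choose, mem_univ _, ?_⟩
    ext i
    refine h _ _ ?_
    have := (hne ⟨μ.part i, μ.part_mem.2 (mem_univ i)⟩).choose_spec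
    exact (μ.mem_part_iff_part_eq_part (mem_univ _) (mem_univ _)).1 this

/-- Orthogonality of characters on the group of strings constant on blocks: the restricted character
is trivial exactly when all block sums of `d` vanish. -/
theorem sum_inputs_stdAddChar (μ : Partition n) (d : Inp n q) :
    ∑ y ∈ inputs q μ, (ZMod.stdAddChar (∑ i, d i * y i) : ℂ)
      = if blockSum μ.part d = 0 then (#(inputs q μ) : ℂ) else 0 := by
  split_ifs with h
  · rw [sum_congr rfl (g := fun _ => (1 : ℂ)), sum_const, nsmul_eq_mul, mul_one]
    intro y hy
    have h0 : ∑ i, d i * y i = 0 := by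
      rw [← sum_fiberwise univ μ.part]
      refine sum_eq_zero fun B _ => ?_
      by_cases hB : ∃ x, μ.part x = B
      · obtain ⟨x, rfl⟩ := hB
        have : ∑ i with μ.part i = μ.part x, d i * y i = blockSum μ.part d x * y x := by
          rw [blockSum, sum_mul]
          exact sum_congr rfl fun i hi => by rw [mem_inputs.1 hy i x (mem_filter.1 hi).2]
        rw [this, h, Pi.zero_apply, zero_mul]
      · refine sum_eq_zero fun i hi => (hB ⟨i, (mem_filter.1 hi).2⟩).elim
    rw [h0, AddChar.map_zero_eq_one]
  · obtain ⟨x, hx⟩ := Function.ne_iff.1 h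
    -- The indicator of a block with nonzero sum: translating by it multiplies the character sum by
    -- a number other than `1`.
    set u : Inp n q := fun i => if μ.part i = μ.part x then 1 else 0 with hu
    have hmem : ∀ y, y ∈ inputs q μ → y + u ∈ inputs q μ := by
      intro y hy
      rw [mem_inputs] at hy ⊢
      intro i j hij
      simp [hu, hij, hy i j hij]
    have hmem' : ∀ y, y ∈ inputs q μ → y - u ∈ inputs q μ := by
      intro y hy
      rw [mem_inputs] at hy ⊢
      intro i j hij
      simp [hu, hij, hy i j hij]
    have hdu : ∀ y : Inp n q, ∑ i, d i * (y + u) i = blockSum μ.part d x + ∑ i, d i * y i := by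
      intro y
      simp only [Pi.add_apply, mul_add, sum_add_distrib, hu, mul_ite, mul_one, mul_zero,
        blockSum, sum_filter]
      ring
    have h1 : ∑ y ∈ inputs q μ, (ZMod.stdAddChar (∑ i, d i * y i) : ℂ)
        = ZMod.stdAddChar (blockSum μ.part d x)
          * ∑ y ∈ inputs q μ, (ZMod.stdAddChar (∑ i, d i * y i) : ℂ) := by
      rw [mul_sum]
      refine sum_nbij' (fun y => y - u) (fun y => y + u) hmem' hmem (by simp) (by simp) ?_
      intro y hy
      rw [← AddChar.map_add_eq_mul, ← hdu, sub_add_cancel]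
    have h2 : (ZMod.stdAddChar (blockSum μ.part d x) : ℂ) ≠ 1 := by
      intro h3
      rw [← AddChar.map_zero_eq_one (ZMod.stdAddChar (N := q))] at h3
      exact hx (ZMod.injective_stdAddChar h3)
    have h4 : (1 - (ZMod.stdAddChar (blockSum μ.part d x) : ℂ))
        * ∑ y ∈ inputs q μ, (ZMod.stdAddChar (∑ i, d i * y i) : ℂ) = 0 := by
      rw [sub_mul, one_mul, ← h1, sub_self]
    exact (mul_eq_zero.1 h4).resolve_left (sub_ne_zero.2 h2.symm)

variable {H : Type*} [NormedAddCommGroup H] [InnerProductSpace ℂ H]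

theorem norm_sum_sq (s : Finset (Inp n q)) (u : Inp n q → H) :
    ((‖∑ σ ∈ s, u σ‖ ^ 2 : ℝ) : ℂ) = ∑ σ ∈ s, ∑ τ ∈ s, inner ℂ (u σ) (u τ) := by
  have h : inner ℂ (∑ σ ∈ s, u σ) (∑ σ ∈ s, u σ) = ((‖∑ σ ∈ s, u σ‖ : ℝ) : ℂ) ^ 2 :=
    inner_self_eq_norm_sq_to_K _
  rw [Complex.ofReal_pow, ← h, sum_inner]
  simp_rw [inner_sum]

theorem norm_coarsen_sq_eq_inner {L : Type} [DecidableEq L] (b : Fin n → L) (u : Inp n q → H) :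
    ((‖coarsen b u‖ ^ 2 : ℝ) : ℂ)
      = ∑ σ, ∑ τ, if blockSum b (τ - σ) = 0 then inner ℂ (u σ) (u τ) else 0 := by
  have h0 : ∀ σ τ : Inp n q, blockSum b (τ - σ) = 0 ↔ blockSum b τ = blockSum b σ := by
    intro σ τ
    have := blockSum_add b (τ - σ) σ
    rw [sub_add_cancel] at this
    rw [this, add_eq_right]
  rw [norm_coarsen_sq, Complex.ofReal_sum]
  refine Eq.trans ?_ (sum_fiberwise univ (blockSum b) _)
  refine sum_congr rfl fun ρ _ => ?_
  rw [norm_sum_sq]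
  refine sum_congr rfl fun σ hσ => ?_
  rw [sum_filter]
  simp_rw [h0, (mem_filter.1 hσ).2]

/-- Parseval's identity on the space of inputs that are constant on the blocks of `μ`. -/
theorem sum_inputs_norm_sq (μ : Partition n) (u : Inp n q → H) :
    ∑ y ∈ inputs q μ, ‖∑ σ, (ZMod.stdAddChar (∑ i, σ i * y i) : ℂ) • u σ‖ ^ 2
      = #(inputs q μ) * ‖coarsen μ.part u‖ ^ 2 := by
  apply Complex.ofReal_injective
  rw [Complex.ofReal_mul, norm_coarsen_sq_eq_inner, Complex.ofReal_sum]
  simp_rw [norm_sum_sq, inner_smul_left, inner_smul_right]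
  rw [sum_comm, mul_sum]
  refine sum_congr rfl fun σ _ => ?_
  rw [sum_comm, mul_sum]
  refine sum_congr rfl fun τ _ => ?_
  have h : ∀ y : Inp n q, (starRingEnd ℂ) (ZMod.stdAddChar (∑ i, σ i * y i) : ℂ)
      * ((ZMod.stdAddChar (∑ i, τ i * y i) : ℂ) * inner ℂ (u σ) (u τ))
      = (ZMod.stdAddChar (∑ i, (τ - σ) i * y i) : ℂ) * inner ℂ (u σ) (u τ) := by
    intro y
    rw [← AddChar.map_neg_eq_conj, ← mul_assoc, ← AddChar.map_add_eq_mul]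
    congr 3
    simp only [Pi.sub_apply, sub_mul, sum_sub_distrib]
    ring
  simp_rw [h]
  rw [← sum_mul, sum_inputs_stdAddChar]
  split_ifs <;> simp

end Parseval

/-! ### The knowledge operator as a coarsening -/

section Knowledge

variable {n q : ℕ} [NeZero q] {H : Type*} [NormedAddCommGroup H] [InnerProductSpace ℂ H]

theorem tensorId_apply_of_fourier {S : Type*} [Fintype S]
    (T : RegX n q →ₗ[ℂ] EuclideanSpace ℂ S) {ψ : Joint (Inp n q) H} {φ : Inp n q → H}
    (h : ∀ x, ψ.ofLp x = ∑ σ, (chi σ).ofLp x • φ σ) (s : S) :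
    (tensorId H T ψ).ofLp s = ∑ σ, (T (chi σ)).ofLp s • φ σ := by
  simp only [tensorId, h, smul_sum]
  rw [sum_comm]
  refine sum_congr rfl fun σ _ => ?_
  have : (chi σ : RegX n q) = ∑ x, (chi σ).ofLp x • EuclideanSpace.single x (1 : ℂ) := by
    ext y
    simp [Pi.single_apply]
  conv_rhs => rw [this, map_sum, WithLp.ofLp_sum, Finset.sum_apply, sum_smul]
  refine sum_congr rfl fun x _ => ?_
  rw [map_smul, PiLp.smul_apply, smul_smul, smul_eq_mul, mul_comm]

open Classical in
theorem knowledgeOp_chi (L : Partition n → Set (Finset (Fin n))) (M : Finset (Partition n))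
    (σ : Inp n q) (p : Σ μ : M, inputs q μ.1) :
    (knowledgeOp L M (chi σ)).ofLp p
      = (√(1 / (#M : ℝ)) * √(1 / (#(inputs q p.1.1) : ℝ)) : ℝ)
        * if supp σ ∈ L p.1.1 then (ZMod.stdAddChar (∑ i, σ i * p.2.1 i) : ℂ) else 0 := by
  have h1 : knowledgeOpμ (q := q) (L p.1.1) p.1.1 (chi σ)
      = if supp σ ∈ L p.1.1 then transfer p.1.1 (chi σ) else 0 := by
    rw [← fourierBasis_apply, ← OrthonormalBasis.coe_toBasis, knowledgeOpμ, Module.Basis.constr_basis,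
      OrthonormalBasis.coe_toBasis, fourierBasis_apply]
  have h2 : (knowledgeOp L M (chi σ)).ofLp p
      = ((√(1 / (#M : ℝ)) : ℝ) : ℂ) * (knowledgeOpμ (L p.1.1) p.1.1 (chi σ)).ofLp p.2 := rfl
  rw [h2, h1, Complex.ofReal_mul, mul_assoc]
  congr 1
  split_ifs
  · have h3 : (transfer p.1.1 (chi σ)).ofLp p.2
        = ((√((q : ℝ) ^ n) * √(1 / (#(inputs q p.1.1) : ℝ)) : ℝ) : ℂ) * (chi σ).ofLp p.2.1 := rfl
    have hq : (√((q : ℝ) ^ n) : ℝ) ≠ 0 := by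
      have : (0 : ℝ) < q := Nat.cast_pos.2 (NeZero.pos q)
      positivity
    rw [h3, chi_apply, ← mul_assoc, ← Complex.ofReal_mul]
    congr 2
    field_simp
  · simp

open Classical in
theorem norm_tensorId_knowledgeOp_sq (L : Partition n → Set (Finset (Fin n)))
    (M : Finset (Partition n)) {ψ : Joint (Inp n q) H} {φ : Inp n q → H}
    (h : ∀ x, ψ.ofLp x = ∑ σ, (chi σ).ofLp x • φ σ) :
    ‖tensorId H (knowledgeOp L M) ψ‖ ^ 2
      = (#M : ℝ)⁻¹ * ∑ μ ∈ M,
        ‖coarsen μ.part fun σ => if supp σ ∈ L μ then φ σ else 0‖ ^ 2 := by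
  rw [PiLp.norm_sq_eq_of_L2, Fintype.sum_sigma, ← sum_coe_sort M, mul_sum]
  refine sum_congr rfl fun μ _ => ?_
  have hpos : (0 : ℝ) < #(inputs q μ.1) := by
    rw [Nat.cast_pos, card_pos]
    exact ⟨0, mem_inputs.2 fun _ _ _ => rfl⟩
  have h1 : ∀ y : inputs q μ.1, ‖(tensorId H (knowledgeOp L M) ψ).ofLp ⟨μ, y⟩‖ ^ 2
      = (#M : ℝ)⁻¹ * (#(inputs q μ.1) : ℝ)⁻¹
        * ‖∑ σ, (ZMod.stdAddChar (∑ i, σ i * y.1 i) : ℂ)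
          • (if supp σ ∈ L μ then φ σ else 0)‖ ^ 2 := by
    intro y
    rw [tensorId_apply_of_fourier _ h]
    simp_rw [knowledgeOp_chi, mul_smul, ← smul_sum]
    rw [norm_smul, mul_pow, Complex.norm_real, Real.norm_eq_abs, sq_abs, mul_pow,
      Real.sq_sqrt (by positivity), Real.sq_sqrt (by positivity), one_div, one_div]
    congr 3
    refine sum_congr rfl fun σ _ => ?_
    simp [ite_smul]
  simp_rw [h1]
  rw [← mul_sum, sum_coe_sort (inputs q μ.1) fun y =>
    ‖∑ σ, (ZMod.stdAddChar (∑ i, σ i * y i) : ℂ) • (if supp σ ∈ L μ then φ σ else 0)‖ ^ 2,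
    sum_inputs_norm_sq]
  field_simp

end Knowledge

/-! ### Averaging over the orbit of a partition -/

section Orbits

variable {n : ℕ}

/-- The partition `π(μ)`. -/
def permPartition (μ : Partition n) (π : Equiv.Perm (Fin n)) : Partition n :=
  Finpartition.ofExistsUnique (μ.parts.image fun B => B.image π) (fun _ _ => subset_univ _)
    (fun x _ => by
      refine ⟨(μ.part (π.symm x)).image π, ⟨mem_image_of_mem _ (μ.part_mem.2 (mem_univ _)),
        mem_image.2 ⟨π.symm x, μ.mem_part (mem_univ _), by simp⟩⟩, ?_⟩
      rintro E ⟨hE, hxE⟩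
      obtain ⟨B, hB, rfl⟩ := mem_image.1 hE
      obtain ⟨y, hy, rfl⟩ := mem_image.1 hxE
      rw [Equiv.symm_apply_apply, μ.part_eq_of_mem hB hy])
    (fun h => by
      obtain ⟨B, hB, hB'⟩ := mem_image.1 h
      exact μ.ne_empty hB (image_eq_empty.1 hB'))

theorem permPartition_parts (μ : Partition n) (π : Equiv.Perm (Fin n)) :
    (permPartition μ π).parts = μ.parts.image fun B => B.image π := rfl

theorem permPartition_mul (μ : Partition n) (π ρ : Equiv.Perm (Fin n)) :
    permPartition μ (π * ρ) = permPartition (permPartition μ ρ) π := by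
  ext1
  simp only [permPartition_parts, image_image]
  congr 1
  ext B : 1
  simp [image_image, Equiv.Perm.coe_mul]

theorem permPartition_one (μ : Partition n) : permPartition μ 1 = μ := by
  ext1
  simp [permPartition_parts]

theorem permPartition_part_eq_iff (μ : Partition n) (π : Equiv.Perm (Fin n)) (x y : Fin n) :
    (permPartition μ π).part x = (permPartition μ π).part y
      ↔ μ.part (π.symm x) = μ.part (π.symm y) := by
  rw [← Finpartition.mem_part_iff_part_eq_part _ (mem_univ _) (mem_univ _),
    ← Finpartition.mem_part_iff_part_eq_part _ (mem_univ _) (mem_univ _),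
    Finpartition.mem_part_iff_exists, Finpartition.mem_part_iff_exists, permPartition_parts]
  simp only [mem_image, exists_exists_and_eq_and]
  refine exists_congr fun B => and_congr_right fun _ => and_congr ?_ ?_
  · exact ⟨fun ⟨z, hz, e⟩ => by rwa [← e, Equiv.symm_apply_apply], fun h => ⟨_, h, by simp⟩⟩
  · exact ⟨fun ⟨z, hz, e⟩ => by rwa [← e, Equiv.symm_apply_apply], fun h => ⟨_, h, by simp⟩⟩

theorem orbit_eq_image [DecidableEq (Partition n)] (μ : Partition n) :
    orbit μ = univ.image (permPartition μ) := by
  ext ν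
  simp only [orbit, mem_filter, mem_univ, true_and, mem_image]
  refine exists_congr fun π => ?_
  constructor
  · intro h
    ext1
    exact h.symm
  · rintro rfl
    rfl

/-- Averaging over the orbit of `μ` is averaging over the symmetric group. -/
theorem orbit_average (μ : Partition n) (F : Partition n → ℝ) :
    (#(orbit μ) : ℝ)⁻¹ * ∑ ν ∈ orbit μ, F ν
      = ((n.factorial : ℕ) : ℝ)⁻¹ * ∑ π : Equiv.Perm (Fin n), F (permPartition μ π) := by
  classical
  set s := #{π | permPartition μ π = μ} with hs
  have hfib : ∀ ν ∈ orbit μ, #{π | permPartition μ π = ν} = s := by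
    intro ν hν
    rw [orbit_eq_image] at hν
    obtain ⟨ρ, -, rfl⟩ := mem_image.1 hν
    -- Left multiplication by `ρ` maps the stabiliser of `μ` onto the fibre over `permPartition μ
    -- ρ`.
    refine (card_bij' (fun π _ => ρ * π) (fun π _ => ρ⁻¹ * π) ?_ ?_ (by simp) (by simp)).symm
    · intro π hπ
      simp only [mem_filter, mem_univ, true_and] at hπ ⊢
      rw [permPartition_mul, hπ]
    · intro π hπ
      simp only [mem_filter, mem_univ, true_and] at hπ ⊢
      rw [permPartition_mul, hπ, ← permPartition_mul, inv_mul_cancel, permPartition_one]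
  have hmaps : ∀ π ∈ (univ : Finset (Equiv.Perm (Fin n))), permPartition μ π ∈ orbit μ := by
    intro π _
    rw [orbit_eq_image]
    exact mem_image_of_mem _ (mem_univ _)
  have h1 : ∑ π : Equiv.Perm (Fin n), F (permPartition μ π) = s * ∑ ν ∈ orbit μ, F ν := by
    rw [← sum_fiberwise_of_maps_to hmaps, mul_sum]
    refine sum_congr rfl fun ν hν => ?_
    rw [sum_congr rfl fun π hπ => by rw [(mem_filter.1 hπ).2], sum_const, hfib ν hν, nsmul_eq_mul]
  have h2 : n.factorial = #(orbit μ) * s := by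
    rw [← smul_eq_mul, ← sum_const, ← sum_congr rfl hfib, ← card_eq_sum_card_fiberwise hmaps,
      card_univ, Fintype.card_perm, Fintype.card_fin]
  have h3 : (s : ℝ) ≠ 0 := by
    intro h
    rw [Nat.cast_eq_zero] at h
    rw [h, mul_zero] at h2
    exact n.factorial_ne_zero h2
  rw [h1, h2, Nat.cast_mul]
  field_simp

theorem blocks_part (μ : Partition n) (l : ℕ) :
    blocks μ.part l = μ.parts.filter fun B => #B = l := by
  ext D
  rw [mem_blocks, mem_filter]
  refine and_congr_left fun _ => ?_
  constructor
  · rintro ⟨x, hx⟩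
    have : D = μ.part x := by
      ext y
      rw [hx, μ.mem_part_iff_part_eq_part (mem_univ _) (mem_univ _)]
    rw [this]
    exact μ.part_mem.2 (mem_univ _)
  · intro hD
    obtain ⟨x, hx⟩ := μ.nonempty_of_mem_parts hD
    refine ⟨x, fun y => ?_⟩
    rw [μ.part_eq_of_mem hD hx, μ.part_eq_iff_mem hD]

theorem card_blocks_part (μ : Partition n) (l : ℕ) : #(blocks μ.part l) = numBlocks μ l := by
  rw [blocks_part, numBlocks]

theorem IsKDistinct.mem_knowledge_iff {k : ℕ} {μ : Partition n} (h : IsKDistinct k μ)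
    {D : Finset (Fin n)} (hD : D ∈ blocks μ.part k) (π : Equiv.Perm (Fin n))
    (S : Finset (Fin n)) :
    S ∈ knowledge k (permPartition μ π) ↔ D.map π.toEmbedding ⊆ S := by
  rw [blocks_part] at hD
  have hk := (mem_filter.1 hD).2
  constructor
  · rintro ⟨E, hE, hkE⟩
    rw [permPartition_parts] at hE
    obtain ⟨B, hB, rfl⟩ := mem_image.1 hE
    have hcard : #(B.image π) = #B := card_image_of_injective _ π.injective
    have h1 : #(S ∩ B.image π) ≤ #(B.image π) := card_le_card inter_subset_right
    have hBk : #B = k := le_antisymm (h.2 B hB) (by lia)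
    have hBD : B = D := card_le_one.1 h.1.le B (mem_filter.2 ⟨hB, hBk⟩) D hD
    have h2 : S ∩ B.image π = B.image π := eq_of_subset_of_card_le inter_subset_right (by lia)
    have h3 : D.map π.toEmbedding = B.image π := hBD ▸ map_eq_image _ _
    rw [h3]
    exact inter_eq_right.1 h2
  · intro hS
    refine ⟨D.image π, mem_image_of_mem _ (mem_filter.1 hD).1, ?_⟩
    rw [inter_eq_right.2 (by simpa [map_eq_image] using hS),
      card_image_of_injective _ π.injective, hk]

end Orbits

/-! ### Symmetrised states form a run, and their weight is the knowledge norm -/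

section Symmetrization

variable {n q : ℕ} [NeZero q] {L : Type} [DecidableEq L]
variable {W : Type*} [NormedAddCommGroup W] [InnerProductSpace ℂ W]

theorem sum_norm_coarsen_nonzeroOn_component_sq (b : Fin n → L) (D : Finset (Fin n))
    (φ : Inp n q → RegA n q W) :
    ∑ p, ‖coarsen b (nonzeroOn D fun σ => (φ σ).ofLp p)‖ ^ 2 = ‖coarsen b (nonzeroOn D φ)‖ ^ 2 := by
  simp_rw [norm_coarsen_sq]
  rw [sum_comm]
  refine sum_congr rfl fun τ _ => ?_
  rw [PiLp.norm_sq_eq_of_L2]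
  refine sum_congr rfl fun p _ => ?_
  rw [WithLp.ofLp_sum, Finset.sum_apply]
  congr 2
  refine sum_congr rfl fun σ _ => ?_
  simp only [nonzeroOn]
  split_ifs <;> rfl

theorem norm_coarsen_nonzeroOn_unitary (b : Fin n → L) (D : Finset (Fin n))
    (U : RegA n q W ≃ₗᵢ[ℂ] RegA n q W) (φ : Inp n q → RegA n q W) :
    ‖coarsen b (nonzeroOn D fun σ => U (φ σ))‖ = ‖coarsen b (nonzeroOn D φ)‖ := by
  refine (sq_eq_sq₀ (norm_nonneg _) (norm_nonneg _)).1 ?_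
  rw [norm_coarsen_sq, norm_coarsen_sq]
  refine sum_congr rfl fun τ _ => ?_
  rw [← U.norm_map (∑ σ with blockSum b σ = τ, nonzeroOn D φ σ), map_sum]
  congr 2
  refine sum_congr rfl fun σ _ => ?_
  simp only [nonzeroOn]
  split_ifs <;> simp

/-- The superposition of the state `φ` over all relabellings of `[n]`. -/
noncomputable def symmetrize (φ : Inp n q → RegA n q W) :
    Equiv.Perm (Fin n) × Fin n × ZMod q → Inp n q → W :=
  fun x σ => ((√(n.factorial : ℝ))⁻¹ : ℝ) • (φ (σ ∘ x.1.symm)).ofLp (x.1 x.2.1, x.2.2)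

theorem isSymmetric_symmetrize (φ : Inp n q → RegA n q W) :
    IsSymmetric (fun x => x.2.1) (symmetrize φ) := by
  intro ρ
  refine ⟨(Equiv.mulRight ρ⁻¹).prodCongr (ρ.prodCongr (Equiv.refl _)), fun x => ⟨rfl, ?_⟩⟩
  ext σ
  have h1 : (x.1 * ρ⁻¹) (ρ x.2.1) = x.1 x.2.1 := by simp
  have h2 : σ ∘ (x.1 * ρ⁻¹).symm = (σ ∘ ρ) ∘ x.1.symm := rfl
  change _ • (φ (σ ∘ (x.1 * ρ⁻¹).symm)).ofLp ((x.1 * ρ⁻¹) (ρ x.2.1), x.2.2) = _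
  rw [h1, h2]
  rfl

/-- Undoing the relabelling `e` moves it from the state to the partition and to `D`; the components
are then summed up again. -/
theorem weight_symmetrize (φ : Inp n q → RegA n q W) (b : Fin n → L) (D : Finset (Fin n)) :
    weight (symmetrize φ) b D = (n.factorial : ℝ)⁻¹ * ∑ e : Equiv.Perm (Fin n),
      ‖coarsen (b ∘ e.symm) (nonzeroOn (D.map e.toEmbedding) φ)‖ ^ 2 := by
  rw [weight, Fintype.sum_prod_type, mul_sum]
  refine sum_congr rfl fun e _ => ?_
  rw [← sum_norm_coarsen_nonzeroOn_component_sq, mul_sum]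
  refine Fintype.sum_equiv (e.prodCongr (Equiv.refl _)) _ _ fun p => ?_
  have h1 : nonzeroOn D (symmetrize φ (e, p)) = (((√(n.factorial : ℝ))⁻¹ : ℝ) : ℂ) •
      nonzeroOn ((D.map e.toEmbedding).map e.symm.toEmbedding)
        (fun σ => (fun σ => (φ σ).ofLp (e p.1, p.2)) (σ ∘ e.symm)) := by
    have h2 : (D.map e.toEmbedding).map e.symm.toEmbedding = D := by
      ext x
      simp
    rw [h2]
    ext σ
    simp only [nonzeroOn, symmetrize, Pi.smul_apply, smul_ite, smul_zero, Complex.coe_smul]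
  rw [h1, map_smul, norm_smul, mul_pow, norm_coarsen_nonzeroOn_comp_perm b _ e.symm
    (fun σ => (φ σ).ofLp (e p.1, p.2)), Complex.norm_real,
    Real.norm_eq_abs, sq_abs, inv_pow, Real.sq_sqrt (Nat.cast_nonneg _)]
  rfl

theorem QueryAlgorithm.isRun (alg : QueryAlgorithm n q W) :
    IsRun (fun x : Equiv.Perm (Fin n) × Fin n × ZMod q => x.2.1) (fun x => x.2.2)
      (fun t => symmetrize (alg.fourierState t))
      (fun t => symmetrize fun σ => alg.U t (alg.fourierState t σ)) where
  init x σ hσ := by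
    have : σ ∘ x.1.symm ≠ 0 := by
      intro h
      refine hσ ?_
      ext i
      simpa using congrFun h (x.1 i)
    simp [symmetrize, fourierState, this]
  norm_init := by
    refine le_of_eq ?_
    have h1 : ∀ x : Equiv.Perm (Fin n) × Fin n × ZMod q,
        ‖symmetrize (alg.fourierState 0) x 0‖ ^ 2
          = (n.factorial : ℝ)⁻¹ * ‖alg.init.ofLp (x.1 x.2.1, x.2.2)‖ ^ 2 := by
      intro x
      have : (0 : Inp n q) ∘ x.1.symm = 0 := rfl
      simp only [symmetrize, fourierState, this, if_true]
      rw [norm_smul, mul_pow, Real.norm_eq_abs, sq_abs, inv_pow, Real.sq_sqrt (Nat.cast_nonneg _)]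
    have h2 : ∀ e : Equiv.Perm (Fin n),
        ∑ p : Fin n × ZMod q, ‖alg.init.ofLp (e p.1, p.2)‖ ^ 2 = 1 := by
      intro e
      rw [Fintype.sum_equiv (e.prodCongr (Equiv.refl (ZMod q)))
        (fun p => ‖alg.init.ofLp (e p.1, p.2)‖ ^ 2) (fun p => ‖alg.init.ofLp p‖ ^ 2)
        fun p => rfl, ← PiLp.norm_sq_eq_of_L2, alg.norm_init,
        one_pow]
    simp_rw [h1]
    rw [← mul_sum, Fintype.sum_prod_type]
    simp_rw [h2]
    rw [sum_const, card_univ, Fintype.card_perm, Fintype.card_fin, nsmul_eq_mul, mul_one,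
      inv_mul_cancel₀ (Nat.cast_ne_zero.2 n.factorial_ne_zero)]
  symm t := isSymmetric_symmetrize _
  symm' t := isSymmetric_symmetrize _
  unitary t L _ b D := by
    rw [weight_symmetrize, weight_symmetrize]
    simp_rw [norm_coarsen_nonzeroOn_unitary]
  query t x σ := by
    have h : (σ - (Pi.single x.2.1 x.2.2 : Inp n q)) ∘ x.1.symm
        = σ ∘ x.1.symm - (Pi.single (x.1 x.2.1) x.2.2 : Inp n q) := by
      ext i
      simp [Pi.single_apply, Equiv.symm_apply_eq]
    simp only [symmetrize, fourierState, h]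

/-- The orbit average becomes an average over permutations, and knowing the image of `D` under `π`
means that `σ` has no zeros there. This is the weight of the symmetrised state term by term. -/
theorem norm_knowledgeState_sq {k : ℕ} {μ : Partition n} (h : IsKDistinct k μ)
    {D : Finset (Fin n)} (hD : D ∈ blocks μ.part k) {ψ : Joint (Inp n q) (RegA n q W)}
    {φ : Inp n q → RegA n q W} (hψ : ∀ x, ψ.ofLp x = ∑ σ, (chi σ).ofLp x • φ σ) :
    ‖knowledgeState k (orbit μ) ψ‖ ^ 2 = weight (symmetrize φ) μ.part D := by
  classical
  refine (norm_tensorId_knowledgeOp_sq (knowledge k) (orbit μ) hψ).trans ?_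
  rw [orbit_average μ fun ν =>
    ‖coarsen ν.part fun σ => if supp σ ∈ knowledge k ν then φ σ else 0‖ ^ 2, weight_symmetrize]
  have key : ∀ π : Equiv.Perm (Fin n),
      (coarsen (permPartition μ π).part fun σ =>
        if supp σ ∈ knowledge k (permPartition μ π) then φ σ else 0)
        = coarsen (μ.part ∘ π.symm) (nonzeroOn (D.map π.toEmbedding) φ) := by
    intro π
    have h1 : (fun σ => if supp σ ∈ knowledge k (permPartition μ π) then φ σ else 0)
        = nonzeroOn (D.map π.toEmbedding) φ := by
      ext1 σ
      have : supp σ ∈ knowledge k (permPartition μ π) ↔ ∀ x ∈ D.map π.toEmbedding, σ x ≠ 0 := by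
        rw [h.mem_knowledge_iff hD]
        simp only [subset_iff, supp, mem_filter, mem_univ, true_and]
      simp only [nonzeroOn, this]
    have h2 : (coarsen (permPartition μ π).part : (Inp n q → RegA n q W) →ₗ[ℂ] _)
        = coarsen (μ.part ∘ π.symm) := coarsen_congr (permPartition_part_eq_iff μ π)
    rw [h1, h2]
  simp_rw [key]

end Symmetrization

end KDist

theorem mainTheorem2 (k : ℕ) (hk : 2 ≤ k) (c : ℝ) (hc : 0 < c) :
    ∃ C : ℝ, 0 < C ∧
      ∀ (n q : ℕ) [NeZero q] (μ : KDist.Partition n),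
        KDist.IsKDistinct k μ →
        (∀ l : ℕ, 1 ≤ l → l ≤ k - 1 → c * (n : ℝ) ≤ (KDist.numBlocks μ l : ℝ)) →
        ∀ (W : Type*) [NormedAddCommGroup W] [InnerProductSpace ℂ W]
          (alg : KDist.QueryAlgorithm n q W) (t : ℕ),
          ‖KDist.knowledgeState k (KDist.orbit μ) (alg.state' t)‖
              = ‖KDist.knowledgeState k (KDist.orbit μ) (alg.state t)‖ ∧
            ‖KDist.knowledgeState k (KDist.orbit μ) (alg.state t)‖
              ≤ C * ((t : ℝ) ^ (2 ^ k - 1) / (n : ℝ) ^ (3 * 2 ^ (k - 2) - 1))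
                  ^ ((1 : ℝ) / 2 ^ (k - 1)) := by
  obtain ⟨C, hC, hmain⟩ := KDist.exists_sqrt_weight_le hc hk
  refine ⟨C, hC, ?_⟩
  intro n q _ μ hμ hblocks W _ _ alg t
  obtain ⟨D, hD⟩ : (KDist.blocks μ.part k).Nonempty := by
    rw [← Finset.card_pos, KDist.card_blocks_part, hμ.1]
    exact one_pos
  have hn : 0 < n := by
    obtain ⟨x, -⟩ := KDist.nonempty_of_mem_blocks hD
    exact x.pos
  have h1 := KDist.norm_knowledgeState_sq hμ hD (alg.state_apply t)
  have h2 := KDist.norm_knowledgeState_sq hμ hD (alg.state'_apply t)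
  refine ⟨?_, ?_⟩
  · refine (sq_eq_sq₀ (norm_nonneg _) (norm_nonneg _)).1 ?_
    rw [h1, h2]
    exact alg.isRun.unitary t _ _ D
  · rw [← KDist.mul_rpow_growthExp_eq hk t hn, ← Real.sqrt_sq (norm_nonneg _), h1]
    refine hmain n q W _ _ _ _ _ alg.isRun hn _ μ.part (fun m hm1 hm2 => ?_) D hD t
    rw [KDist.card_blocks_part]
    exact hblocks m hm1 hm2
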